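/- Let $d\ge 1$, let $\rho$ be a state on $\mathbb{C}^d$ (a positive semidefinite $d\times d$ matrix of trace $1$) and $H$ a Hermitian $d\times d$ matrix. For a state $\sigma$ put $\sigma_\theta=e^{-i\theta H}\sigma e^{i\theta H}$. The quantum Fisher information (QFI) and the sub-QFI of this family at $\theta\in\mathbb{R}$ are $$I(\sigma_\theta)=8\lim_{\delta\to0}\frac{1-F(\sigma_\theta,\sigma_{\theta+\delta})}{\delta^2},\qquad \mathcal I(\sigma_\theta)=8\lim_{\delta\to0}\frac{1-\sqrt{G(\sigma_\theta,\sigma_{\theta+\delta})}}{\delta^2},$$ where $F(\rho,\sigma)=\|\sqrt\rho\sqrt\sigma\|_1$ with $\|A\|_1=\mathrm{Tr}\sqrt{AA^\dagger}$, and $G(\rho,\sigma)=\mathrm{Tr}[\rho\sigma]+\sqrt{(1-\mathrm{Tr}\,\rho^2)(1-\mathrm{Tr}\,\sigma^2)}$. Then for every $\theta\in\mathbb{R}$ both limits exist for every state $\sigma=U\rho U^\dagger$ with $U$ a $d\times d$ unitary; the sub-QFI attains its maximum over all such $U$; and a unitary maximizes the sub-QFI if and only if it maximizes the QFI: $$\operatorname*{arg\,max}_{U}\,\mathcal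 I\big((U\rho U^\dagger)_\theta\big)=\operatorname*{arg\,max}_{U}\,I\big((U\rho U^\dagger)_\theta\big)\neq\emptyset .$$ Moreover, let $\rho=\sum_{j=1}^d\lambda_j|\lambda_j\rangle\langle\lambda_j|$ and $H=\sum_{j=1}^d h_j|h_j\rangle\langle h_j|$ be spectral decompositions in orthonormal bases with $\lambda_1\ge\dots\ge\lambda_d$ and $h_1\ge\dots\ge h_d$, let $\chi\in\mathbb{R}$, and let $$|\phi_j\rangle=\begin{cases}\frac1{\sqrt2}\big(|h_j\rangle+e^{i\chi}|h_{d-j+1}\rangle\big)&(2j<d+1)\\ |h_j\rangle&(2j=d+1)\\ \frac1{\sqrt2}\big(|h_j\rangle-e^{-i\chi}|h_{d-j+1}\rangle\big)&(2j>d+1).\end{cases}$$ Then $\rho^*=\sum_{j=1}^d\lambda_j|\phi_j\rangle\langle\phi_j|$ is of the form $U\rho U^\dagger$ for some unitary $U$, and every unitary $U$ with $U\rho U^\dagger=\rho^*$ maximizes both the sub-QFI and the QFI. -/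

import Mathlib

open Filter Topology
open scoped Matrix ComplexOrder

namespace SubQFI

/-- A quantum state (density matrix): positive semidefinite with unit trace. -/
def IsState {d : ℕ} (ρ : Matrix (Fin d) (Fin d) ℂ) : Prop :=
  ρ.PosSemidef ∧ ρ.trace = 1

/-- The positive square root of a positive semidefinite matrix, by functional calculus. -/
noncomputable def msqrt {d : ℕ} (A : Matrix (Fin d) (Fin d) ℂ) : Matrix (Fin d) (Fin d) ℂ :=
  cfc Real.sqrt A

/-- The trace norm `Tr √(A A†)`. -/
noncomputable def traceNorm {d : ℕ} (A : Matrix (Fin d) (Fin d) ℂ) : ℝ :=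
  (msqrt (A * Aᴴ)).trace.re

/-- Uhlmann's fidelity `‖√ρ √σ‖₁` (without a square). -/
noncomputable def fidelity {d : ℕ} (ρ σ : Matrix (Fin d) (Fin d) ℂ) : ℝ :=
  traceNorm (msqrt ρ * msqrt σ)

/-- The super-fidelity `Tr[ρσ] + √((1 - Tr ρ²)(1 - Tr σ²))`. -/
noncomputable def superFidelity {d : ℕ} (ρ σ : Matrix (Fin d) (Fin d) ℂ) : ℝ :=
  (ρ * σ).trace.re + Real.sqrt ((1 - (ρ * ρ).trace.re) * (1 - (σ * σ).trace.re))

/-- The unitary `W_θ = e^{-iθH}`. -/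
noncomputable def W {d : ℕ} (H : Matrix (Fin d) (Fin d) ℂ) (θ : ℝ) :
    Matrix (Fin d) (Fin d) ℂ :=
  NormedSpace.exp ((-Complex.I * (θ : ℂ)) • H)

/-- The unitary family `ρ_θ = W_θ ρ W_θ†`. -/
noncomputable def family {d : ℕ} (H ρ : Matrix (Fin d) (Fin d) ℂ) (θ : ℝ) :
    Matrix (Fin d) (Fin d) ℂ :=
  W H θ * ρ * (W H θ)ᴴ

/-- The quotient `8 (1 - F(ρ_θ, ρ_{θ+δ})) / δ²`, whose limit as `δ → 0` is the QFI. -/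
noncomputable def qfiQuotient {d : ℕ} (r : ℝ → Matrix (Fin d) (Fin d) ℂ) (θ δ : ℝ) : ℝ :=
  8 * ((1 - fidelity (r θ) (r (θ + δ))) / δ ^ 2)

/-- The quotient `8 (1 - √G(ρ_θ, ρ_{θ+δ})) / δ²`, whose limit as `δ → 0` is the sub-QFI. -/
noncomputable def subQfiQuotient {d : ℕ} (r : ℝ → Matrix (Fin d) (Fin d) ℂ) (θ δ : ℝ) : ℝ :=
  8 * ((1 - Real.sqrt (superFidelity (r θ) (r (θ + δ)))) / δ ^ 2)

/-- The quantum Fisher information at `θ` of a one-parameter family of states. -/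
noncomputable def qfi {d : ℕ} (r : ℝ → Matrix (Fin d) (Fin d) ℂ) (θ : ℝ) : ℝ :=
  limUnder (𝓝[≠] (0 : ℝ)) (qfiQuotient r θ)

/-- The sub-quantum Fisher information at `θ` of a one-parameter family of states. -/
noncomputable def subQfi {d : ℕ} (r : ℝ → Matrix (Fin d) (Fin d) ℂ) (θ : ℝ) : ℝ :=
  limUnder (𝓝[≠] (0 : ℝ)) (subQfiQuotient r θ)

/-- The probe state `U ρ U†`. -/
def prep {d : ℕ} (ρ : Matrix (Fin d) (Fin d) ℂ) (U : Matrix.unitaryGroup (Fin d) ℂ) :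
    Matrix (Fin d) (Fin d) ℂ :=
  (U : Matrix (Fin d) (Fin d) ℂ) * ρ * (U : Matrix (Fin d) (Fin d) ℂ)ᴴ

/-- The unitaries `U` that maximize the QFI of the family generated from `U ρ U†` by `H`. -/
def argmaxQfi {d : ℕ} (ρ H : Matrix (Fin d) (Fin d) ℂ) (θ : ℝ) :
    Set (Matrix.unitaryGroup (Fin d) ℂ) :=
  {U | ∀ V : Matrix.unitaryGroup (Fin d) ℂ,
    qfi (family H (prep ρ V)) θ ≤ qfi (family H (prep ρ U)) θ}

/-- The unitaries `U` that maximize the sub-QFI of the family generated from `U ρ U†` by `H`. -/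
def argmaxSubQfi {d : ℕ} (ρ H : Matrix (Fin d) (Fin d) ℂ) (θ : ℝ) :
    Set (Matrix.unitaryGroup (Fin d) ℂ) :=
  {U | ∀ V : Matrix.unitaryGroup (Fin d) ℂ,
    subQfi (family H (prep ρ V)) θ ≤ subQfi (family H (prep ρ U)) θ}

/-- `Σ_j l_j |v_j⟩⟨v_j|`. -/
noncomputable def spectralSum {d : ℕ} (l : Fin d → ℝ) (v : Fin d → EuclideanSpace ℂ (Fin d)) :
    Matrix (Fin d) (Fin d) ℂ :=
  ∑ j, (l j : ℂ) • Matrix.vecMulVec (v j).ofLp (star (v j).ofLp)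

/-- The optimal vectors `φ_j` built from the eigenvectors `b_j` of the generator. The index set is
`{0, …, d-1}`, so that `j.rev = d - 1 - j` is the partner of `j`. -/
noncomputable def optVec {d : ℕ} (b : Fin d → EuclideanSpace ℂ (Fin d)) (χ : ℝ) (j : Fin d) :
    EuclideanSpace ℂ (Fin d) :=
  if j < j.rev then
    ((1 / Real.sqrt 2 : ℝ) : ℂ) • (b j + Complex.exp (Complex.I * (χ : ℂ)) • b j.rev)
  else if j = j.rev then b j
  else
    ((1 / Real.sqrt 2 : ℝ) : ℂ) • (b j - Complex.exp (-(Complex.I * (χ : ℂ))) • b j.rev)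

end SubQFI

/-! Write the probe state as `V * realDiag l * Vᴴ` with `l` decreasing, and put `K = Vᴴ * H * V`.
Second-order expansions give both limits in closed form, independent of `θ`: the sub-QFI is 2 Σ (l_j
- l_k)² |K_jk|² and the QFI is 2 Σ (l_j - l_k)²/(l_j + l_k) |K_jk|². The sub-QFI only needs the
expansion of a trace. For the QFI the fidelity is squeezed between two smooth functions with the
same second-order coefficient: a lower bound Re Tr(ZA) ≤ ‖A‖₁ with Z unitary, and an upper bound of
Alberti type, F(ρ,σ) ≤ (Tr ρP + Tr σP⁻¹)/2 (`tendsto_qfiQuotient`).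

Both quantities thus have the form Σ g(l_j, l_k) |K_jk|². Summation by parts turns such a sum into a
combination of block sums Σ_{j<m, k≥n} |K_jk|² with m ≤ n, whose coefficients are mixed second
differences of g. For both weights these coefficients are nonnegative, and they are positive at the
same places: the pairs of strict gaps of `l` (`subQfiBlockCoeff_sign`, `qfiBlockCoeff_sign`).

Each block sum is at most Σ (h_i - h_{rev i})²/4 over the `i` with i < m and rev i ≥ n
(`weightedSum_blockWeight_le`). This follows from von Neumann's trace inequality applied to K and
its off-diagonal block, whose spectrum is symmetric and whose rank is small. The vectors `optVec`
attain all these bounds at once (`weightedSum_blockWeight_optMatrix`). Hence maximizing either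
quantity means saturating the block bounds at all gap pairs, a condition that does not see which
weight was used. -/

namespace SubQFI

/-! ### Second-order expansions at zero -/

section Expansion

/-- `f δ = a + δ b + δ² c + o(δ²)` as `δ → 0`. -/
def HasExpansion {E : Type*} [AddCommGroup E] [Module ℝ E] [TopologicalSpace E]
    (f : ℝ → E) (a b c : E) : Prop :=
  Tendsto (fun δ : ℝ => (δ ^ 2)⁻¹ • (f δ - a - δ • b)) (𝓝[≠] 0) (𝓝 c)

theorem hasExpansion_const {E : Type*} [AddCommGroup E] [Module ℝ E] [TopologicalSpace E]
    (a : E) : HasExpansion (fun _ => a) a 0 0 := by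
  simpa [HasExpansion] using tendsto_const_nhds

theorem HasExpansion.add {E : Type*} [AddCommGroup E] [Module ℝ E] [TopologicalSpace E]
    [ContinuousAdd E] {f g : ℝ → E} {a b c a' b' c' : E}
    (hf : HasExpansion f a b c) (hg : HasExpansion g a' b' c') :
    HasExpansion (fun δ => f δ + g δ) (a + a') (b + b') (c + c') := by
  refine (Tendsto.add hf hg).congr fun δ => ?_
  module

theorem HasExpansion.map {E F : Type*} [AddCommGroup E] [Module ℝ E] [TopologicalSpace E]
    [AddCommGroup F] [Module ℝ F] [TopologicalSpace F] (φ : E →L[ℝ] F)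
    {f : ℝ → E} {a b c : E} (hf : HasExpansion f a b c) :
    HasExpansion (fun δ => φ (f δ)) (φ a) (φ b) (φ c) := by
  refine ((φ.continuous.tendsto c).comp hf).congr fun δ => ?_
  simp

theorem HasExpansion.mul {E : Type*} [Ring E] [Algebra ℝ E] [TopologicalSpace E]
    [IsTopologicalRing E] [ContinuousSMul ℝ E] {f g : ℝ → E} {a b c a' b' c' : E}
    (hf : HasExpansion f a b c) (hg : HasExpansion g a' b' c') :
    HasExpansion (fun δ => f δ * g δ) (a * a') (a * b' + b * a') (a * c' + b * b' + c * a') := by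
  have hδ : Tendsto (fun δ : ℝ => δ) (𝓝[≠] 0) (𝓝 0) := tendsto_id.mono_left nhdsWithin_le_nhds
  unfold HasExpansion at *
  set F := fun δ : ℝ => (δ ^ 2)⁻¹ • (f δ - a - δ • b) with hF
  set G := fun δ : ℝ => (δ ^ 2)⁻¹ • (g δ - a' - δ • b') with hG
  -- The quadratic remainder of the product, sorted by powers of δ; the terms carrying δ and δ²
  -- vanish in the limit.
  have key : Tendsto (fun δ : ℝ => (a * G δ + b * b' + F δ * a') +
      δ • (b * G δ + F δ * b') + (δ ^ 2) • (F δ * G δ)) (𝓝[≠] 0)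
      (𝓝 ((a * c' + b * b' + c * a') + (0 : ℝ) • (b * c' + c * b') + ((0 : ℝ) ^ 2) • (c * c'))) :=
    ((((hg.const_mul a).add tendsto_const_nhds).add (hf.mul_const a')).add
      (hδ.smul ((hg.const_mul b).add (hf.mul_const b')))).add ((hδ.pow 2).smul (hf.mul hg))
  rw [show (a * c' + b * b' + c * a') + (0 : ℝ) • (b * c' + c * b') + ((0 : ℝ) ^ 2) • (c * c')
    = a * c' + b * b' + c * a' by simp] at key
  refine key.congr' ?_
  filter_upwards [self_mem_nhdsWithin] with δ hδ0
  have hδ0 : δ ≠ 0 := hδ0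
  have h1 : f δ = a + δ • b + (δ ^ 2) • F δ := by
    simp only [hF]; rw [smul_inv_smul₀ (pow_ne_zero 2 hδ0)]; abel
  have h2 : g δ = a' + δ • b' + (δ ^ 2) • G δ := by
    simp only [hG]; rw [smul_inv_smul₀ (pow_ne_zero 2 hδ0)]; abel
  rw [eq_inv_smul_iff₀ (pow_ne_zero 2 hδ0), h1, h2]
  simp only [mul_add, add_mul, smul_mul_assoc, mul_smul_comm]
  module

theorem hasExpansion_exp_of_normed {𝔸 : Type*} [NormedRing 𝔸] [NormedAlgebra ℝ 𝔸]
    [Algebra ℚ 𝔸] [CompleteSpace 𝔸] (x : 𝔸) :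
    HasExpansion (fun δ : ℝ => NormedSpace.exp (δ • x)) 1 x ((1 / 2 : ℝ) • (x * x)) := by
  have h := (NormedSpace.exp_hasFPowerSeriesAt_zero (𝕂 := ℝ) (𝔸 := 𝔸)).isBigO_sub_partialSum_pow 3
  have hx : Tendsto (fun δ : ℝ => δ • x) (𝓝[≠] 0) (𝓝 0) := by
    have : Tendsto (fun δ : ℝ => δ • x) (𝓝[≠] 0) (𝓝 ((0 : ℝ) • x)) :=
      (tendsto_id.mono_left nhdsWithin_le_nhds).smul_const x
    simpa using this
  have h2 := h.comp_tendsto hx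
  have h3 : (fun δ : ℝ => NormedSpace.exp (δ • x) - 1 - δ • x - (δ ^ 2) • ((1 / 2 : ℝ) • (x * x)))
      =O[𝓝[≠] 0] (fun δ : ℝ => δ ^ 3) := by
    have h4 : (fun δ : ℝ => NormedSpace.exp (δ • x) - 1 - δ • x -
        (δ ^ 2) • ((1 / 2 : ℝ) • (x * x))) = 
        (fun y : 𝔸 => NormedSpace.exp (0 + y) -
          (NormedSpace.expSeries ℝ 𝔸).partialSum 3 y) ∘ fun δ : ℝ => δ • x := by
      funext δ
      simp [FormalMultilinearSeries.partialSum, Finset.sum_range_succ,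
        NormedSpace.expSeries_apply_eq, pow_two, smul_smul]
      module
    rw [h4]
    refine h2.trans ?_
    refine Asymptotics.IsBigO.of_bound (‖x‖ ^ 3) (Eventually.of_forall fun δ => ?_)
    simp [norm_smul, mul_pow, mul_comm]
  unfold HasExpansion
  have h5 : (fun δ : ℝ => (δ ^ 2)⁻¹ •
      (NormedSpace.exp (δ • x) - 1 - δ • x - (δ ^ 2) • ((1 / 2 : ℝ) • (x * x))))
      =O[𝓝[≠] 0] (fun δ : ℝ => (δ ^ 2)⁻¹ • δ ^ 3) := (Asymptotics.isBigO_refl _ _).smul h3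
  have h6 : Tendsto (fun δ : ℝ => (δ ^ 2)⁻¹ • δ ^ 3) (𝓝[≠] 0) (𝓝 0) := by
    refine (tendsto_id.mono_left nhdsWithin_le_nhds : Tendsto (fun δ : ℝ => δ) _ _).congr' ?_
    filter_upwards [self_mem_nhdsWithin] with δ hδ0
    have hδ0 : δ ≠ 0 := hδ0
    simp only [smul_eq_mul, id]
    field_simp
  have h7 := (h5.trans_tendsto h6).add_const ((1 / 2 : ℝ) • (x * x))
  rw [zero_add] at h7
  refine h7.congr' ?_
  filter_upwards [self_mem_nhdsWithin] with δ hδ0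
  have hδ0 : δ ≠ 0 := hδ0
  rw [smul_sub, inv_smul_smul₀ (pow_ne_zero 2 hδ0)]
  abel

attribute [local instance] Matrix.linftyOpNormedRing Matrix.linftyOpNormedAlgebra in
theorem hasExpansion_exp {d : ℕ} (X : Matrix (Fin d) (Fin d) ℂ) :
    HasExpansion (fun δ : ℝ => NormedSpace.exp (δ • X)) 1 X ((1 / 2 : ℝ) • (X * X)) :=
  hasExpansion_exp_of_normed X

/-- The real part of the trace, as a continuous real-linear map. -/
noncomputable def reTrace (d : ℕ) : Matrix (Fin d) (Fin d) ℂ →L[ℝ] ℝ where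
  toFun A := A.trace.re
  map_add' := by simp
  map_smul' := by simp
  cont := Complex.continuous_re.comp (continuous_id.matrix_trace)

@[simp] theorem reTrace_apply {d : ℕ} (A : Matrix (Fin d) (Fin d) ℂ) :
    reTrace d A = A.trace.re := rfl

theorem HasExpansion.tendsto_quotient {f : ℝ → ℝ} {c : ℝ} (h : HasExpansion f 1 0 c) :
    Tendsto (fun δ : ℝ => 8 * ((1 - f δ) / δ ^ 2)) (𝓝[≠] 0) (𝓝 (-8 * c)) := by
  refine (Tendsto.const_mul (-8) h).congr fun δ => ?_
  simp only [smul_eq_mul]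
  ring

/-- Since 1 - √f = (1 - f)/(1 + √f) and the denominator tends to 2, the square root halves the
limit. -/
theorem HasExpansion.tendsto_sqrt_quotient {f : ℝ → ℝ} {c : ℝ} (h : HasExpansion f 1 0 c)
    (hf : Tendsto f (𝓝[≠] 0) (𝓝 1)) :
    Tendsto (fun δ : ℝ => 8 * ((1 - √(f δ)) / δ ^ 2)) (𝓝[≠] 0) (𝓝 (-4 * c)) := by
  have h1 : Tendsto (fun δ => (1 + √(f δ))⁻¹) (𝓝[≠] 0) (𝓝 (2⁻¹)) := by
    have h2 := ((Real.continuous_sqrt.tendsto 1).comp hf).const_add 1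
    have h3 := h2.inv₀ (by simp)
    convert h3 using 2
    simp; norm_num
  have h4 := (h.tendsto_quotient).mul h1
  rw [show -8 * c * 2⁻¹ = -4 * c by ring] at h4
  refine h4.congr' ?_
  filter_upwards [hf.eventually (lt_mem_nhds (zero_lt_one))] with δ hδ
  have h5 : 1 - f δ = (1 - √(f δ)) * (1 + √(f δ)) := by
    nlinarith [Real.mul_self_sqrt hδ.le]
  have h6 : 1 + √(f δ) ≠ 0 := by positivity
  rw [h5]
  field_simp

end Expansion

/-! ### Square roots and variational bounds for the trace norm -/

section TraceNorm

variable {d : ℕ}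

/-- The real diagonal matrix with diagonal `l`, viewed over `ℂ`. -/
def realDiag (l : Fin d → ℝ) : Matrix (Fin d) (Fin d) ℂ := Matrix.diagonal fun i => (l i : ℂ)

theorem realDiag_mul (l m : Fin d → ℝ) : realDiag l * realDiag m = realDiag fun i => l i * m i := by
  simp [realDiag, Matrix.diagonal_mul_diagonal]

@[simp] theorem conjTranspose_realDiag (l : Fin d → ℝ) : (realDiag l)ᴴ = realDiag l := by
  simp only [realDiag, Matrix.diagonal_conjTranspose]
  congr 1
  funext i
  simp

theorem posSemidef_realDiag {l : Fin d → ℝ} (hl : ∀ i, 0 ≤ l i) : (realDiag l).PosSemidef := by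
  refine Matrix.PosSemidef.diagonal fun i => ?_
  simpa using hl i

theorem trace_realDiag (l : Fin d → ℝ) : (realDiag l).trace.re = ∑ i, l i := by
  simp [realDiag, Matrix.trace_diagonal]

@[simp] theorem unitary_conjTranspose_mul (U : Matrix.unitaryGroup (Fin d) ℂ) :
    (U : Matrix (Fin d) (Fin d) ℂ)ᴴ * U = 1 := U.2.1

@[simp] theorem unitary_mul_conjTranspose (U : Matrix.unitaryGroup (Fin d) ℂ) :
    (U : Matrix (Fin d) (Fin d) ℂ) * (U : Matrix (Fin d) (Fin d) ℂ)ᴴ = 1 := U.2.2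

@[simp] theorem unitary_conjTranspose_mul_assoc (U : Matrix.unitaryGroup (Fin d) ℂ)
    (X : Matrix (Fin d) (Fin d) ℂ) :
    (U : Matrix (Fin d) (Fin d) ℂ)ᴴ * (U * X) = X := by
  rw [← mul_assoc, unitary_conjTranspose_mul, one_mul]

@[simp] theorem unitary_mul_conjTranspose_assoc (U : Matrix.unitaryGroup (Fin d) ℂ)
    (X : Matrix (Fin d) (Fin d) ℂ) :
    (U : Matrix (Fin d) (Fin d) ℂ) * ((U : Matrix (Fin d) (Fin d) ℂ)ᴴ * X) = X := by
  rw [← mul_assoc, unitary_mul_conjTranspose, one_mul]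

theorem exists_unitary_comp_perm (C : Matrix.unitaryGroup (Fin d) ℂ) (l : Fin d → ℝ)
    (s : Equiv.Perm (Fin d)) : ∃ C' : Matrix.unitaryGroup (Fin d) ℂ,
      (C : Matrix (Fin d) (Fin d) ℂ) * realDiag l * (C : Matrix (Fin d) (Fin d) ℂ)ᴴ =
        C' * realDiag (l ∘ s) * (C' : Matrix (Fin d) (Fin d) ℂ)ᴴ := by
  let P : Matrix (Fin d) (Fin d) ℂ := s.symm.toPEquiv.toMatrix
  have h1 : Pᴴ = s.toPEquiv.toMatrix := by
    ext i j
    have h : s.symm j = i ↔ s i = j := by rw [Equiv.symm_apply_eq, eq_comm]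
    by_cases hs : s i = j
    · simp [P, PEquiv.toMatrix_apply, Equiv.toPEquiv_apply, h, hs]
    · simp [P, PEquiv.toMatrix_apply, Equiv.toPEquiv_apply, h, hs]
  have h2 : P * Pᴴ = 1 := by
    rw [h1, ← PEquiv.toMatrix_trans, ← Equiv.toPEquiv_trans]; simp
  have h3 : Pᴴ * P = 1 := by
    rw [h1, ← PEquiv.toMatrix_trans, ← Equiv.toPEquiv_trans]; simp
  refine ⟨C * ⟨P, h3, h2⟩, ?_⟩
  have h4 : P * realDiag (l ∘ s) * Pᴴ = realDiag l := by
    rw [h1, PEquiv.toMatrix_toPEquiv_mul, PEquiv.mul_toMatrix_toPEquiv]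
    ext i j
    simp [realDiag, Matrix.diagonal_apply]
  rw [← h4]
  simp [mul_assoc, P]

theorem exists_unitary_realDiag {A : Matrix (Fin d) (Fin d) ℂ} (hA : A.IsHermitian) :
    ∃ (C : Matrix.unitaryGroup (Fin d) ℂ) (l : Fin d → ℝ),
      A = C * realDiag l * (C : Matrix (Fin d) (Fin d) ℂ)ᴴ ∧ Antitone l := by
  -- `Tuple.sort` orders increasingly; composing with the reversal makes the eigenvalues decreasing.
  obtain ⟨C, hC⟩ := exists_unitary_comp_perm hA.eigenvectorUnitary hA.eigenvalues
    (Fin.revPerm.trans (Tuple.sort hA.eigenvalues))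
  refine ⟨C, _, Eq.trans ?_ hC, fun i j hij => ?_⟩
  · exact hA.spectral_theorem
  · have := Tuple.monotone_sort hA.eigenvalues (Fin.rev_le_rev.mpr hij)
    simpa using this

open scoped MatrixOrder in
theorem msqrt_mul_self {B : Matrix (Fin d) (Fin d) ℂ} (hB : B.PosSemidef) :
    msqrt (B * B) = B := by
  have hs : IsSelfAdjoint B := hB.1
  have h1 : B * B = cfc (fun x : ℝ => x ^ 2) B := by
    rw [cfc_pow_id (R := ℝ) B 2, pow_two]
  rw [msqrt, h1, ← cfc_comp' Real.sqrt (fun x : ℝ => x ^ 2) B]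
  conv_rhs => rw [← cfc_id ℝ B]
  refine cfc_congr fun x hx => ?_
  have : 0 ≤ x := spectrum_nonneg_of_nonneg (Matrix.nonneg_iff_posSemidef.mpr hB) hx
  simp [Real.sqrt_sq this]

theorem conj_realDiag_mul_conj (C : Matrix.unitaryGroup (Fin d) ℂ) (l m : Fin d → ℝ) :
    ((C : Matrix (Fin d) (Fin d) ℂ) * realDiag l * (C : Matrix (Fin d) (Fin d) ℂ)ᴴ) *
      ((C : Matrix (Fin d) (Fin d) ℂ) * realDiag m * (C : Matrix (Fin d) (Fin d) ℂ)ᴴ) =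
      C * realDiag (fun i => l i * m i) * (C : Matrix (Fin d) (Fin d) ℂ)ᴴ := by
  simp [mul_assoc, ← realDiag_mul]

theorem posSemidef_conj (C : Matrix.unitaryGroup (Fin d) ℂ) {l : Fin d → ℝ} (hl : ∀ i, 0 ≤ l i) :
    ((C : Matrix (Fin d) (Fin d) ℂ) * realDiag l * (C : Matrix (Fin d) (Fin d) ℂ)ᴴ).PosSemidef :=
  (posSemidef_realDiag hl).mul_mul_conjTranspose_same _

theorem nonneg_of_posSemidef_conj (C : Matrix.unitaryGroup (Fin d) ℂ) {l : Fin d → ℝ}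
    (h : ((C : Matrix (Fin d) (Fin d) ℂ) * realDiag l *
      (C : Matrix (Fin d) (Fin d) ℂ)ᴴ).PosSemidef) (i : Fin d) : 0 ≤ l i := by
  have h1 := h.conjTranspose_mul_mul_same (C : Matrix (Fin d) (Fin d) ℂ)
  simp only [mul_assoc, unitary_conjTranspose_mul, mul_one, unitary_conjTranspose_mul_assoc] at h1
  have h2 := h1.diag_nonneg (i := i)
  simpa [realDiag] using h2

theorem msqrt_conj (C : Matrix.unitaryGroup (Fin d) ℂ) {l : Fin d → ℝ} (hl : ∀ i, 0 ≤ l i) :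
    msqrt ((C : Matrix (Fin d) (Fin d) ℂ) * realDiag l * (C : Matrix (Fin d) (Fin d) ℂ)ᴴ) =
      C * realDiag (fun i => √(l i)) * (C : Matrix (Fin d) (Fin d) ℂ)ᴴ := by
  have h := msqrt_mul_self (posSemidef_conj C (l := fun i => √(l i)) fun i => Real.sqrt_nonneg _)
  rw [conj_realDiag_mul_conj] at h
  simpa only [Real.mul_self_sqrt (hl _)] using h

theorem trace_conj (C : Matrix.unitaryGroup (Fin d) ℂ) (X : Matrix (Fin d) (Fin d) ℂ) :
    ((C : Matrix (Fin d) (Fin d) ℂ) * X * (C : Matrix (Fin d) (Fin d) ℂ)ᴴ).trace = X.trace := by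
  rw [Matrix.trace_mul_comm]; simp

/-- The squared Hilbert–Schmidt norm. -/
noncomputable def hsSq (X : Matrix (Fin d) (Fin d) ℂ) : ℝ := (Xᴴ * X).trace.re

theorem hsSq_eq_sum (X : Matrix (Fin d) (Fin d) ℂ) : hsSq X = ∑ i, ∑ j, Complex.normSq (X i j) := by
  rw [Finset.sum_comm]
  simp [hsSq, Matrix.trace, Matrix.mul_apply, Complex.normSq_apply]

theorem hsSq_nonneg (X : Matrix (Fin d) (Fin d) ℂ) : 0 ≤ hsSq X := by
  rw [hsSq_eq_sum]
  exact Finset.sum_nonneg fun i _ => Finset.sum_nonneg fun j _ => Complex.normSq_nonneg _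

theorem re_trace_conjTranspose (X : Matrix (Fin d) (Fin d) ℂ) : (Xᴴ).trace.re = X.trace.re := by
  simp [Matrix.trace_conjTranspose]

theorem two_mul_re_trace_le (X Y : Matrix (Fin d) (Fin d) ℂ) :
    2 * (Xᴴ * Y).trace.re ≤ hsSq X + hsSq Y := by
  have h := hsSq_nonneg (X - Y)
  have h2 := re_trace_conjTranspose (Xᴴ * Y)
  simp only [Matrix.conjTranspose_mul, Matrix.conjTranspose_conjTranspose] at h2
  simp only [hsSq, Matrix.conjTranspose_sub, sub_mul, mul_sub, Matrix.trace_sub,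
    Complex.sub_re] at *
  linarith

/-- The spectral data behind the trace norm of `A`. -/
theorem exists_singular_decomposition (A : Matrix (Fin d) (Fin d) ℂ) :
    ∃ (C : Matrix.unitaryGroup (Fin d) ℂ) (t : Fin d → ℝ), (∀ i, 0 ≤ t i) ∧
      A * Aᴴ = C * realDiag (fun i => t i * t i) * (C : Matrix (Fin d) (Fin d) ℂ)ᴴ ∧
      traceNorm A = ∑ i, t i := by
  have hB : (A * Aᴴ).PosSemidef := Matrix.posSemidef_self_mul_conjTranspose A
  obtain ⟨C, l, h1, -⟩ := exists_unitary_realDiag hB.1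
  have hl : ∀ i, 0 ≤ l i := nonneg_of_posSemidef_conj C (h1 ▸ hB)
  refine ⟨C, fun i => √(l i), fun i => Real.sqrt_nonneg _, ?_, ?_⟩
  · simpa only [Real.mul_self_sqrt (hl _)] using h1
  · rw [traceNorm, h1, msqrt_conj C hl, trace_conj, trace_realDiag]

/-- In the basis `C` of left singular vectors, row `i` of `Cᴴ * A` has norm `t i` and the columns of
`Z * C` are unit vectors, so Cauchy–Schwarz bounds each diagonal entry by `t i`. -/
theorem re_trace_unitary_mul_le_traceNorm (Z : Matrix.unitaryGroup (Fin d) ℂ)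
    (A : Matrix (Fin d) (Fin d) ℂ) :
    ((Z : Matrix (Fin d) (Fin d) ℂ) * A).trace.re ≤ traceNorm A := by
  obtain ⟨C, t, ht, h1, h2⟩ := exists_singular_decomposition A
  rw [h2]
  set B : Matrix (Fin d) (Fin d) ℂ := (C : Matrix (Fin d) (Fin d) ℂ)ᴴ * A with hB
  set V : Matrix (Fin d) (Fin d) ℂ := Z * C with hV
  have hBB : B * Bᴴ = realDiag fun i => t i * t i := by
    rw [hB, Matrix.conjTranspose_mul, Matrix.conjTranspose_conjTranspose]
    calc _ = (C : Matrix (Fin d) (Fin d) ℂ)ᴴ * (A * Aᴴ) * C := by simp only [mul_assoc]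
      _ = _ := by rw [h1]; simp [mul_assoc]
  have hVV : Vᴴ * V = 1 := by simp [hV, Matrix.conjTranspose_mul, mul_assoc]
  have htr : ((Z : Matrix (Fin d) (Fin d) ℂ) * A).trace = (B * V).trace := by
    rw [Matrix.trace_mul_comm B V, hV, hB, mul_assoc, unitary_mul_conjTranspose_assoc]
  rw [htr, Matrix.trace, Complex.re_sum]
  refine Finset.sum_le_sum fun i _ => ?_
  have e1 : ∑ j, Complex.normSq (B i j) = t i * t i := by
    have := congrFun (congrFun hBB i) i
    simp only [Matrix.mul_apply, Matrix.conjTranspose_apply, realDiag,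
      Matrix.diagonal_apply_eq] at this
    have := congrArg Complex.re this
    simpa [Complex.normSq_apply] using this
  have e2 : ∑ j, Complex.normSq (V j i) = 1 := by
    have := congrFun (congrFun hVV i) i
    simp only [Matrix.mul_apply, Matrix.conjTranspose_apply, Matrix.one_apply_eq] at this
    have := congrArg Complex.re this
    simpa [Complex.normSq_apply] using this
  rw [Matrix.diag_apply, Matrix.mul_apply]
  calc (∑ j, B i j * V j i).re ≤ ‖∑ j, B i j * V j i‖ := Complex.re_le_norm _
    _ ≤ ∑ j, ‖B i j‖ * ‖V j i‖ := (norm_sum_le _ _).trans (by simp)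
    _ ≤ t i := by
      refine abs_le_of_sq_le_sq' ?_ (ht i) |>.2
      refine (Finset.sum_mul_sq_le_sq_mul_sq _ _ _).trans ?_
      simp only [← Complex.normSq_eq_norm_sq, e1, e2]
      nlinarith

/-- `Q` is an orthogonal projection and `hsSq X - hsSq (V * X)` equals `hsSq (X - Q * X)`. -/
theorem hsSq_mul_le_of_idempotent (V Q : Matrix (Fin d) (Fin d) ℂ) (hQ : Vᴴ * V = Q)
    (hQQ : Q * Q = Q) (X : Matrix (Fin d) (Fin d) ℂ) : hsSq (V * X) ≤ hsSq X := by
  have hQh : Qᴴ = Q := by simp [← hQ, Matrix.conjTranspose_mul]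
  have h3 := hsSq_nonneg (X - Q * X)
  have e2 : (X - Q * X)ᴴ * (X - Q * X) = Xᴴ * X - Xᴴ * Q * X := by
    rw [Matrix.conjTranspose_sub, Matrix.conjTranspose_mul, hQh]
    have : Xᴴ * Q * (Q * X) = Xᴴ * Q * X := by
      rw [mul_assoc, ← mul_assoc Q Q, hQQ, mul_assoc]
    rw [sub_mul, mul_sub, mul_sub, this, mul_assoc, sub_self, sub_zero]
  have e3 : (V * X)ᴴ * (V * X) = Xᴴ * Q * X := by
    rw [Matrix.conjTranspose_mul, ← hQ]
    simp only [mul_assoc]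
  rw [hsSq, e2, Matrix.trace_sub, Complex.sub_re, ← e3] at h3
  exact sub_nonneg.mp h3

theorem exists_partial_isometry (A : Matrix (Fin d) (Fin d) ℂ) :
    ∃ V : Matrix (Fin d) (Fin d) ℂ, (V * Aᴴ).trace.re = traceNorm A ∧
      ∀ X, hsSq (V * X) ≤ hsSq X := by
  obtain ⟨C, t, ht, h1, h2⟩ := exists_singular_decomposition A
  -- `D` is the pseudo-inverse of (AAᴴ)^{1/2}: the convention 0⁻¹ = 0 inverts only the nonzero
  -- singular values. Then `D * A` is the partial isometry of the polar decomposition.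
  obtain ⟨D, hD⟩ : ∃ D : Matrix (Fin d) (Fin d) ℂ,
    D = C * realDiag (fun i => (t i)⁻¹) * (C : Matrix (Fin d) (Fin d) ℂ)ᴴ := ⟨_, rfl⟩
  have hDD : Dᴴ = D := by simp [hD, Matrix.conjTranspose_mul, mul_assoc]
  have hidem : (D * D) * (A * Aᴴ) * (D * D) = D * D := by
    rw [h1, hD, conj_realDiag_mul_conj, conj_realDiag_mul_conj, conj_realDiag_mul_conj]
    congr 3
    funext i
    rcases eq_or_ne (t i) 0 with h | h
    · simp [h]
    · field_simp
  refine ⟨D * A, ?_, hsSq_mul_le_of_idempotent _ (Aᴴ * (D * D) * A) ?_ ?_⟩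
  · rw [h2, mul_assoc, h1, hD, conj_realDiag_mul_conj, trace_conj, trace_realDiag]
    refine Finset.sum_congr rfl fun i _ => ?_
    rcases eq_or_ne (t i) 0 with h | h
    · simp [h]
    · field_simp
  · rw [Matrix.conjTranspose_mul, hDD]
    simp only [mul_assoc]
  · calc _ = Aᴴ * ((D * D) * (A * Aᴴ) * (D * D)) * A := by simp only [mul_assoc]
      _ = _ := by rw [hidem]

/-- Write the trace norm as Re Tr(V (RS)ᴴ) with V the polar partial isometry, insert `Z * Z' = 1`
between Sᴴ and Rᴴ, and use 2 Re⟨X, Y⟩ ≤ ‖X‖² + ‖Y‖². Only invertibility of `Z` enters, which leaves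
it free to be optimized. -/
theorem two_mul_traceNorm_mul_le (R S Z Z' : Matrix (Fin d) (Fin d) ℂ) (hZ : Z * Z' = 1) :
    2 * traceNorm (R * S) ≤ hsSq (Sᴴ * Z) + hsSq (R * Z'ᴴ) := by
  obtain ⟨V, h1, h2⟩ := exists_partial_isometry (R * S)
  have e3 : (V * (R * S)ᴴ).trace.re = ((R * Z'ᴴ)ᴴ * (V * (Sᴴ * Z))).trace.re := by
    have e4 : (R * Z'ᴴ)ᴴ = Z' * Rᴴ := by
      rw [Matrix.conjTranspose_mul, Matrix.conjTranspose_conjTranspose]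
    rw [e4, Matrix.trace_mul_comm (Z' * Rᴴ)]
    congr 2
    calc V * (R * S)ᴴ = V * (Sᴴ * (1 * Rᴴ)) := by rw [Matrix.conjTranspose_mul, one_mul]
      _ = _ := by rw [← hZ]; simp only [mul_assoc]
  rw [← h1, e3]
  have := two_mul_re_trace_le (R * Z'ᴴ) (V * (Sᴴ * Z))
  have := h2 (Sᴴ * Z)
  linarith

end TraceNorm

/-! ### Closed forms of the sub-QFI and the QFI -/

section Limits

variable {d : ℕ}

theorem HasExpansion.tendsto {E : Type*} [AddCommGroup E] [Module ℝ E] [TopologicalSpace E]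
    [ContinuousAdd E] [ContinuousSMul ℝ E] {f : ℝ → E} {a b c : E} (hf : HasExpansion f a b c) :
    Tendsto f (𝓝[≠] 0) (𝓝 a) := by
  have hδ : Tendsto (fun δ : ℝ => δ) (𝓝[≠] 0) (𝓝 0) := tendsto_id.mono_left nhdsWithin_le_nhds
  have h := ((hδ.pow 2).smul hf).add ((hδ.smul_const b).const_add a)
  simp only [ne_eq, OfNat.ofNat_ne_zero, not_false_eq_true, zero_pow, zero_smul, add_zero,
    zero_add] at h
  refine h.congr' ?_
  filter_upwards [self_mem_nhdsWithin] with δ hδ0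
  rw [smul_inv_smul₀ (pow_ne_zero 2 hδ0)]
  abel

theorem W_conjTranspose {K : Matrix (Fin d) (Fin d) ℂ} (hK : K.IsHermitian) (t : ℝ) :
    (W K t)ᴴ = W (-K) t := by
  rw [W, W, ← Matrix.exp_conjTranspose, Matrix.conjTranspose_smul, hK.eq]
  congr 1
  simp

theorem W_mul_W_neg (K : Matrix (Fin d) (Fin d) ℂ) (t : ℝ) : W K t * W (-K) t = 1 := by
  rw [W, W, ← Matrix.exp_add_of_commute _ _ (by simp)]
  simp

theorem W_add (K : Matrix (Fin d) (Fin d) ℂ) (s t : ℝ) : W K (s + t) = W K s * W K t := by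
  rw [W, W, W, ← Matrix.exp_add_of_commute _ _ (((Commute.refl K).smul_left _).smul_right _)]
  congr 1
  rw [← add_smul]
  push_cast
  ring_nf

/-- `e^{-itK}` as an element of the unitary group. -/
noncomputable def unitaryW {K : Matrix (Fin d) (Fin d) ℂ} (hK : K.IsHermitian) (t : ℝ) :
    Matrix.unitaryGroup (Fin d) ℂ :=
  ⟨W K t, by
    rw [Matrix.mem_unitaryGroup_iff, Matrix.star_eq_conjTranspose, W_conjTranspose hK,
      W_mul_W_neg]⟩

@[simp] theorem coe_unitaryW {K : Matrix (Fin d) (Fin d) ℂ} (hK : K.IsHermitian) (t : ℝ) :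
    (unitaryW hK t : Matrix (Fin d) (Fin d) ℂ) = W K t := rfl

theorem isHermitian_conj {H : Matrix (Fin d) (Fin d) ℂ} (hH : H.IsHermitian)
    (V : Matrix (Fin d) (Fin d) ℂ) : (Vᴴ * H * V).IsHermitian := by
  simp [Matrix.IsHermitian, Matrix.conjTranspose_mul, hH.eq, mul_assoc]

theorem W_conj (H : Matrix (Fin d) (Fin d) ℂ) (V : Matrix.unitaryGroup (Fin d) ℂ) (t : ℝ) :
    W H t * (V : Matrix (Fin d) (Fin d) ℂ) =
      (V : Matrix (Fin d) (Fin d) ℂ) * W ((V : Matrix (Fin d) (Fin d) ℂ)ᴴ * H * (V : Matrix (Fin d) (Fin d) ℂ)) t := by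
  let u : (Matrix (Fin d) (Fin d) ℂ)ˣ := ⟨V, (V : Matrix (Fin d) (Fin d) ℂ)ᴴ, by simp, by simp⟩
  have h := Matrix.exp_units_conj' u ((-Complex.I * (t : ℂ)) • H)
  have h1 : ((u⁻¹ : (Matrix (Fin d) (Fin d) ℂ)ˣ) : Matrix (Fin d) (Fin d) ℂ) = (V : Matrix (Fin d) (Fin d) ℂ)ᴴ := rfl
  have h2 : (u : Matrix (Fin d) (Fin d) ℂ) = V := rfl
  rw [h1, h2] at h
  rw [W, W, ← smul_mul_assoc, ← mul_smul_comm, h]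
  simp [mul_assoc]

theorem hasExpansion_W (K : Matrix (Fin d) (Fin d) ℂ) :
    HasExpansion (W K) 1 (-Complex.I • K) (-(1 / 2 : ℂ) • (K * K)) := by
  have h := hasExpansion_exp (-Complex.I • K)
  have e : (fun δ : ℝ => NormedSpace.exp (δ • (-Complex.I • K))) = W K := by
    funext δ
    rw [W]
    congr 1
    ext i j
    simp
    ring
  rw [e] at h
  convert h using 1
  ext i j
  simp [← mul_assoc]

theorem family_conj (H : Matrix (Fin d) (Fin d) ℂ) (hH : H.IsHermitian)
    (V : Matrix.unitaryGroup (Fin d) ℂ) (l : Fin d → ℝ) (θ : ℝ) :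
    family H ((V : Matrix (Fin d) (Fin d) ℂ) * realDiag l * (V : Matrix (Fin d) (Fin d) ℂ)ᴴ) θ =
      ((unitaryW hH θ * V : Matrix.unitaryGroup (Fin d) ℂ) : Matrix (Fin d) (Fin d) ℂ) *
        realDiag l *
        ((unitaryW hH θ * V : Matrix.unitaryGroup (Fin d) ℂ) : Matrix (Fin d) (Fin d) ℂ)ᴴ := by
  simp [family, mul_assoc, Matrix.conjTranspose_mul]

/-- In the moving eigenbasis the shift by δ is a right factor e^{-iδK}. The states at θ and θ + δ
are therefore a common conjugate of `realDiag l` and its e^{-iδK}-rotation, and θ drops out of every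
unitarily invariant quantity. -/
theorem unitaryW_add_mul {H : Matrix (Fin d) (Fin d) ℂ} (hH : H.IsHermitian)
    (V : Matrix.unitaryGroup (Fin d) ℂ) (θ δ : ℝ) :
    unitaryW hH (θ + δ) * V =
      unitaryW hH θ * V * unitaryW (isHermitian_conj hH (V : Matrix (Fin d) (Fin d) ℂ)) δ := by
  apply Subtype.ext
  simp only [Submonoid.coe_mul, coe_unitaryW, W_add]
  rw [mul_assoc, W_conj H V δ, ← mul_assoc]

theorem traceNorm_conj (T : Matrix.unitaryGroup (Fin d) ℂ) (A : Matrix (Fin d) (Fin d) ℂ) :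
    traceNorm ((T : Matrix (Fin d) (Fin d) ℂ) * A * (T : Matrix (Fin d) (Fin d) ℂ)ᴴ) =
      traceNorm A := by
  obtain ⟨C, t, ht, h1, h2⟩ := exists_singular_decomposition A
  have e : ((T : Matrix (Fin d) (Fin d) ℂ) * A * (T : Matrix (Fin d) (Fin d) ℂ)ᴴ) *
      ((T : Matrix (Fin d) (Fin d) ℂ) * A * (T : Matrix (Fin d) (Fin d) ℂ)ᴴ)ᴴ =
      ((T * C : Matrix.unitaryGroup (Fin d) ℂ) : Matrix (Fin d) (Fin d) ℂ) *
        realDiag (fun i => t i * t i) *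
        ((T * C : Matrix.unitaryGroup (Fin d) ℂ) : Matrix (Fin d) (Fin d) ℂ)ᴴ := by
    calc _ = (T : Matrix (Fin d) (Fin d) ℂ) * (A * Aᴴ) * (T : Matrix (Fin d) (Fin d) ℂ)ᴴ := by
          simp [Matrix.conjTranspose_mul, mul_assoc]
      _ = _ := by rw [h1]; simp [Matrix.conjTranspose_mul, mul_assoc]
  rw [traceNorm, e, msqrt_conj _ fun i => mul_self_nonneg (t i), trace_conj, trace_realDiag, h2]
  exact Finset.sum_congr rfl fun i _ => Real.sqrt_mul_self (ht i)

theorem fidelity_conj (T E : Matrix.unitaryGroup (Fin d) ℂ) {l : Fin d → ℝ} (hl : ∀ i, 0 ≤ l i) :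
    fidelity ((T : Matrix (Fin d) (Fin d) ℂ) * realDiag l * (T : Matrix (Fin d) (Fin d) ℂ)ᴴ)
      (((T * E : Matrix.unitaryGroup (Fin d) ℂ) : Matrix (Fin d) (Fin d) ℂ) * realDiag l *
        ((T * E : Matrix.unitaryGroup (Fin d) ℂ) : Matrix (Fin d) (Fin d) ℂ)ᴴ) =
      traceNorm (realDiag (fun i => √(l i)) * ((E : Matrix (Fin d) (Fin d) ℂ) *
        realDiag (fun i => √(l i)) * (E : Matrix (Fin d) (Fin d) ℂ)ᴴ)) := by
  rw [fidelity, msqrt_conj T hl, msqrt_conj (T * E) hl]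
  refine Eq.trans ?_ (traceNorm_conj T _)
  congr 1
  simp [Matrix.conjTranspose_mul, mul_assoc]

/-- `Σ_{jk} w_{jk} |K_{jk}|²`. -/
noncomputable def weightedSum (w : Fin d → Fin d → ℝ) (K : Matrix (Fin d) (Fin d) ℂ) : ℝ :=
  ∑ j, ∑ k, w j k * Complex.normSq (K j k)

theorem weightedSum_swap (w : Fin d → Fin d → ℝ) {K : Matrix (Fin d) (Fin d) ℂ}
    (hK : K.IsHermitian) : weightedSum (fun j k => w k j) K = weightedSum w K := by
  rw [weightedSum, weightedSum, Finset.sum_comm]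
  refine Finset.sum_congr rfl fun j _ => Finset.sum_congr rfl fun k _ => ?_
  rw [← hK.apply k j, ← Complex.normSq_conj (K j k)]
  rfl

theorem weightedSum_symm (w : Fin d → Fin d → ℝ) {K : Matrix (Fin d) (Fin d) ℂ}
    (hK : K.IsHermitian) :
    weightedSum w K = weightedSum (fun j k => (w j k + w k j) / 2) K := by
  have h := weightedSum_swap w hK
  have h2 : weightedSum (fun j k => (w j k + w k j) / 2) K =
      (weightedSum w K + weightedSum (fun j k => w k j) K) / 2 := by
    simp only [weightedSum, ← Finset.sum_add_distrib, Finset.sum_div]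
    refine Finset.sum_congr rfl fun j _ => Finset.sum_congr rfl fun k _ => ?_
    ring
  rw [h2, h]
  ring

/-- |K_jk|² is symmetric, so only the symmetric part of a weight matters; later coefficient
identities are checked after this symmetrization. -/
theorem weightedSum_eq_of_symm_eq {w w' : Fin d → Fin d → ℝ} {K : Matrix (Fin d) (Fin d) ℂ}
    (hK : K.IsHermitian) (h : ∀ j k, w j k + w k j = w' j k + w' k j) :
    weightedSum w K = weightedSum w' K := by
  rw [weightedSum_symm w hK, weightedSum_symm w' hK]
  simp only [h]

theorem trace_mul_realDiag_mul_realDiag (A B : Matrix (Fin d) (Fin d) ℂ) (u v : Fin d → ℝ) :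
    (A * realDiag u * B * realDiag v).trace.re =
      ∑ j, ∑ k, (u k * v j) * (A j k * B k j).re := by
  rw [Matrix.trace, Complex.re_sum]
  refine Finset.sum_congr rfl fun j _ => ?_
  rw [Matrix.diag_apply, realDiag, realDiag, Matrix.mul_diagonal, Matrix.mul_apply, Finset.sum_mul,
    Complex.re_sum]
  refine Finset.sum_congr rfl fun k _ => ?_
  rw [Matrix.mul_diagonal]
  simp
  ring

/-- Multiplying entrywise by a coefficient array. -/
def schur (s : Fin d → Fin d → ℂ) (K : Matrix (Fin d) (Fin d) ℂ) : Matrix (Fin d) (Fin d) ℂ :=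
  Matrix.of fun j k => s j k * K j k

theorem isHermitian_schur {s : Fin d → Fin d → ℂ} (hs : ∀ j k, star (s k j) = s j k)
    {K : Matrix (Fin d) (Fin d) ℂ} (hK : K.IsHermitian) : (schur s K).IsHermitian := by
  ext j k
  simp only [Matrix.conjTranspose_apply, schur, Matrix.of_apply, star_mul', hs, hK.apply]

/-- The passage from traces to weighted sums: every second-order coefficient below is evaluated
through it. -/
theorem trace_schur_mul_schur (s s' : Fin d → Fin d → ℂ) {K : Matrix (Fin d) (Fin d) ℂ}
    (hK : K.IsHermitian) (u v : Fin d → ℝ) :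
    (schur s K * realDiag u * schur s' K * realDiag v).trace.re =
      weightedSum (fun j k => u k * v j * (s j k * s' k j).re) K := by
  rw [trace_mul_realDiag_mul_realDiag, weightedSum]
  refine Finset.sum_congr rfl fun j _ => Finset.sum_congr rfl fun k _ => ?_
  simp only [schur, Matrix.of_apply]
  rw [← hK.apply k j]
  have : s j k * K j k * (s' k j * star (K j k)) = s j k * s' k j * (Complex.normSq (K j k) : ℂ) := by
    rw [Complex.normSq_eq_conj_mul_self]
    simp only [starRingEnd_apply]
    ring
  rw [this, Complex.re_mul_ofReal]
  ring

theorem schur_one (K : Matrix (Fin d) (Fin d) ℂ) : schur (fun _ _ => 1) K = K := by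
  ext; simp [schur]

theorem realDiag_one : realDiag (fun _ : Fin d => 1) = 1 := by
  simp [realDiag]

theorem weightedSum_linear (c₁ c₂ : ℝ) (w₁ w₂ : Fin d → Fin d → ℝ) (K : Matrix (Fin d) (Fin d) ℂ) :
    c₁ * weightedSum w₁ K + c₂ * weightedSum w₂ K =
      weightedSum (fun j k => c₁ * w₁ j k + c₂ * w₂ j k) K := by
  simp only [weightedSum, Finset.mul_sum, ← Finset.sum_add_distrib]
  refine Finset.sum_congr rfl fun j _ => Finset.sum_congr rfl fun k _ => ?_
  ring

/-- The real weights of the quantum Fisher information. -/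
noncomputable def qfiWeight (x y : ℝ) : ℝ := (x - y) ^ 2 / (x + y)

theorem trace_mul_self_mul_realDiag {K : Matrix (Fin d) (Fin d) ℂ} (hK : K.IsHermitian)
    (s : Fin d → Fin d → ℂ) (hs : ∀ j k, star (s k j) = s j k) (l : Fin d → ℝ) :
    (schur s K * schur s K * realDiag l).trace.re =
      weightedSum (fun j k => l j * Complex.normSq (s j k)) K := by
  have h := trace_schur_mul_schur s s hK (fun _ => 1) l
  rw [realDiag_one, mul_one] at h
  rw [h]
  congr 1
  funext j k
  rw [← hs k j]
  simp [Complex.normSq_apply]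

theorem weightedSum_mul_left (c : ℝ) (w : Fin d → Fin d → ℝ) (K : Matrix (Fin d) (Fin d) ℂ) :
    c * weightedSum w K = weightedSum (fun j k => c * w j k) K := by
  simpa using weightedSum_linear c 0 w w K

theorem weightedSum_add (w w' : Fin d → Fin d → ℝ) (K : Matrix (Fin d) (Fin d) ℂ) :
    weightedSum w K + weightedSum w' K = weightedSum (fun j k => w j k + w' j k) K := by
  simpa using weightedSum_linear 1 1 w w' K

theorem im_trace_mul_realDiag {X : Matrix (Fin d) (Fin d) ℂ} (hX : X.IsHermitian) (l : Fin d → ℝ) :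
    (X * realDiag l).trace.im = 0 := by
  have h : star (X * realDiag l).trace = (X * realDiag l).trace := by
    rw [← Matrix.trace_conjTranspose, Matrix.conjTranspose_mul, conjTranspose_realDiag, hX.eq,
      Matrix.trace_mul_comm]
  exact Complex.conj_eq_iff_im.mp h

theorem HasExpansion.of_eq {E : Type*} [AddCommGroup E] [Module ℝ E] [TopologicalSpace E]
    {f g : ℝ → E} {a b c a' b' c' : E} (h : HasExpansion f a b c) (hf : ∀ δ, g δ = f δ)
    (ha : a' = a) (hb : b' = b) (hc : c' = c) : HasExpansion g a' b' c' := by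
  rw [show g = f from funext hf, ha, hb, hc]
  exact h

theorem hasExpansion_unitary_conj {K : Matrix (Fin d) (Fin d) ℂ} (hK : K.IsHermitian)
    (D : Matrix (Fin d) (Fin d) ℂ) :
    HasExpansion (fun δ => W K δ * D * (W K δ)ᴴ) D (Complex.I • (D * K - K * D))
      (K * D * K - (1 / 2 : ℂ) • (K * K * D + D * (K * K))) := by
  have h := ((hasExpansion_W K).mul (hasExpansion_const D)).mul (hasExpansion_W (-K))
  refine h.of_eq (fun δ => by rw [W_conjTranspose hK]) ?_ ?_ ?_
  · simp
  · simp only [smul_neg, neg_smul, mul_zero, zero_add, mul_one, one_mul,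
      neg_neg, smul_mul_assoc, mul_smul_comm, neg_mul, smul_sub]
    module
  · simp only [smul_neg, neg_smul, mul_zero, add_zero, zero_add, mul_one, one_mul,
      neg_neg, smul_mul_assoc, mul_smul_comm, neg_mul, mul_neg, smul_smul, Complex.I_mul_I]
    module

theorem subFidelity_expansion {K : Matrix (Fin d) (Fin d) ℂ} (hK : K.IsHermitian) (l : Fin d → ℝ) :
    HasExpansion (fun δ => (realDiag l * (W K δ * realDiag l * (W K δ)ᴴ)).trace.re)
      (∑ i, l i * l i) 0 (-(1 / 2) * weightedSum (fun j k => (l j - l k) ^ 2) K) := by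
  have h := ((hasExpansion_const (realDiag l)).mul
    (hasExpansion_unitary_conj hK (realDiag l))).map (reTrace d)
  refine h.of_eq (fun δ => by simp) ?_ ?_ ?_
  · simp [realDiag_mul, trace_realDiag]
  · have f : (realDiag l * (realDiag l * K)).trace = (realDiag l * (K * realDiag l)).trace := by
      rw [Matrix.trace_mul_comm (realDiag l) (K * realDiag l), mul_assoc, Matrix.trace_mul_comm K,
        mul_assoc]
    simp [mul_sub, f]
  · have e1 := trace_mul_self_mul_realDiag hK (fun _ _ => 1) (by simp) (fun i => l i * l i)
    have e2 := trace_schur_mul_schur (fun _ _ => 1) (fun _ _ => 1) hK l l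
    rw [schur_one] at e1 e2
    have f1 : (realDiag l * (K * (K * realDiag l))).trace =
        (K * K * realDiag fun i => l i * l i).trace := by
      rw [Matrix.trace_mul_comm, ← realDiag_mul]; simp only [mul_assoc]
    have f2 : (realDiag l * (K * (realDiag l * K))).trace =
        (K * realDiag l * K * realDiag l).trace := by
      rw [Matrix.trace_mul_comm]; simp only [mul_assoc]
    have f3 : (realDiag l * (realDiag l * (K * K))).trace =
        (K * K * realDiag fun i => l i * l i).trace := by
      rw [← mul_assoc, Matrix.trace_mul_comm, ← realDiag_mul]
    have e3 : (realDiag l * (K * realDiag l * K -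
        (1 / 2 : ℂ) • (K * K * realDiag l + realDiag l * (K * K)))).trace =
        (K * realDiag l * K * realDiag l).trace - (K * K * realDiag fun i => l i * l i).trace := by
      simp only [mul_sub, mul_smul_comm, mul_add, mul_assoc, Matrix.trace_sub, Matrix.trace_smul,
        Matrix.trace_add, smul_eq_mul] at *
      rw [f1, f2, f3]
      ring
    simp only [reTrace_apply, zero_mul, add_zero, e3, Complex.sub_re, e1, e2]
    rw [weightedSum_mul_left, sub_eq_add_neg, ← neg_one_mul (weightedSum _ K),
      weightedSum_mul_left, weightedSum_add]
    refine weightedSum_eq_of_symm_eq hK fun j k => ?_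
    simp
    ring

theorem tendsto_subQfiQuotient {H : Matrix (Fin d) (Fin d) ℂ} (hH : H.IsHermitian)
    (V : Matrix.unitaryGroup (Fin d) ℂ) {l : Fin d → ℝ} (hl : ∀ i, 0 ≤ l i) (hl1 : ∑ i, l i = 1)
    (θ : ℝ) :
    Tendsto (subQfiQuotient (family H ((V : Matrix (Fin d) (Fin d) ℂ) * realDiag l *
      (V : Matrix (Fin d) (Fin d) ℂ)ᴴ)) θ) (𝓝[≠] 0)
      (𝓝 (2 * weightedSum (fun j k => (l j - l k) ^ 2)
        ((V : Matrix (Fin d) (Fin d) ℂ)ᴴ * H * (V : Matrix (Fin d) (Fin d) ℂ)))) := by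
  have hK := isHermitian_conj hH (V : Matrix (Fin d) (Fin d) ℂ)
  generalize hKdef : (V : Matrix (Fin d) (Fin d) ℂ)ᴴ * H * (V : Matrix (Fin d) (Fin d) ℂ) = K at hK
  -- Both states have the same purity, and since it is at most 1 the square root in the
  -- super-fidelity is exactly 1 minus that purity.
  have hsq : ∑ i, l i * l i ≤ 1 := by
    rw [← hl1]
    refine Finset.sum_le_sum fun i _ => ?_
    have : l i ≤ 1 := hl1 ▸ Finset.single_le_sum (fun j _ => hl j) (Finset.mem_univ i)
    nlinarith [hl i]
  have h := (subFidelity_expansion hK l).add (hasExpansion_const (1 - ∑ i, l i * l i))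
  simp only [add_sub_cancel, add_zero] at h
  have h2 := h.tendsto_sqrt_quotient h.tendsto
  convert h2 using 1
  · funext δ
    rw [subQfiQuotient]
    congr 5
    rw [family_conj H hH, family_conj H hH, unitaryW_add_mul hH V θ δ, superFidelity]
    generalize unitaryW hH θ * V = T
    have e1 : ∀ U : Matrix.unitaryGroup (Fin d) ℂ,
        (((U : Matrix (Fin d) (Fin d) ℂ) * realDiag l * (U : Matrix (Fin d) (Fin d) ℂ)ᴴ) *
        ((U : Matrix (Fin d) (Fin d) ℂ) * realDiag l * (U : Matrix (Fin d) (Fin d) ℂ)ᴴ)).trace.re =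
        ∑ i, l i * l i := fun U => by
      rw [conj_realDiag_mul_conj, trace_conj, trace_realDiag]
    rw [e1, e1, Real.sqrt_mul_self (by linarith)]
    congr 2
    refine Eq.trans ?_ (trace_conj T _)
    congr 1
    rw [Submonoid.coe_mul, coe_unitaryW, hKdef]
    simp [Matrix.conjTranspose_mul, mul_assoc]
  · congr 1
    ring

/-- The linear term vanishes because Tr(XD) and Tr(KD), with D = `realDiag l`, are real and enter
multiplied by ±i. -/
theorem qfi_lower_expansion {K X : Matrix (Fin d) (Fin d) ℂ} (hK : K.IsHermitian)
    (hX : X.IsHermitian) (l r : Fin d → ℝ) (hr : ∀ i, r i * r i = l i) :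
    HasExpansion (fun δ => (W (-X) δ * (realDiag r * W K δ * realDiag r)).trace.re)
      (∑ i, l i) 0 ((X * realDiag r * K * realDiag r).trace.re -
        1 / 2 * (X * X * realDiag l).trace.re - 1 / 2 * (K * K * realDiag l).trace.re) := by
  have h := ((hasExpansion_W (-X)).mul (((hasExpansion_const (realDiag r)).mul
    (hasExpansion_W K)).mul (hasExpansion_const (realDiag r)))).map (reTrace d)
  have hrr : realDiag r * realDiag r = realDiag l := by simp only [realDiag_mul, hr]
  refine h.of_eq (fun δ => by simp) ?_ ?_ ?_
  · simp [hrr, trace_realDiag]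
  · have f : (realDiag r * (K * realDiag r)).trace = (K * realDiag l).trace := by
      rw [Matrix.trace_mul_comm, mul_assoc, hrr]
    simp [mul_assoc, f, hrr, im_trace_mul_realDiag hX, im_trace_mul_realDiag hK]
  · have f : (realDiag r * (K * (K * realDiag r))).trace = (K * (K * realDiag l)).trace := by
      rw [Matrix.trace_mul_comm, mul_assoc, mul_assoc, hrr]
    simp [mul_assoc, f, hrr]
    ring

/-- The linear term vanishes: a commutator has trace zero, and the contributions of L and -L cancel.
-/
theorem qfi_upper_expansion {K L : Matrix (Fin d) (Fin d) ℂ} (hK : K.IsHermitian) (l : Fin d → ℝ) :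
    HasExpansion (fun δ => 1 / 2 * ((W K δ * realDiag l * (W K δ)ᴴ *
        NormedSpace.exp (δ • -L)).trace.re + (NormedSpace.exp (δ • L) * realDiag l).trace.re))
      (∑ i, l i) 0 (1 / 2 * ((L * L * realDiag l).trace.re +
        (Complex.I • ((K * realDiag l - realDiag l * K) * L)).trace.re)) := by
  have h := ((((hasExpansion_unitary_conj hK (realDiag l)).mul (hasExpansion_exp (-L))).map
    (reTrace d)).add (((hasExpansion_exp L).mul (hasExpansion_const (realDiag l))).map
    (reTrace d))).map ((1 / 2 : ℝ) • ContinuousLinearMap.id ℝ ℝ)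
  refine h.of_eq (fun δ => by simp) ?_ ?_ ?_
  · simp [trace_realDiag]
    ring
  · simp [Matrix.trace_mul_comm K, Matrix.trace_mul_comm L]
  · have f1 : (K * (realDiag l * K)).trace = (K * (K * realDiag l)).trace := by
      rw [Matrix.trace_mul_comm, mul_assoc, Matrix.trace_mul_comm, mul_assoc]
    have f2 : (realDiag l * (K * K)).trace = (K * (K * realDiag l)).trace := by
      rw [Matrix.trace_mul_comm, mul_assoc]
    have f3 : (realDiag l * (L * L)).trace = (L * (L * realDiag l)).trace := by
      rw [Matrix.trace_mul_comm, mul_assoc]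
    simp [mul_assoc, sub_mul, f1, f2, f3]
    ring

/-- This X maximizes the concave quadratic coefficient: it solves DX + XD = 2RKR with D = `realDiag
l` and R = `realDiag r`. -/
theorem qfi_lower_coefficient {K : Matrix (Fin d) (Fin d) ℂ} (hK : K.IsHermitian) {l r : Fin d → ℝ}
    (hl : ∀ i, 0 ≤ l i) (hr : ∀ i, r i * r i = l i) {X : Matrix (Fin d) (Fin d) ℂ}
    (hX : X = schur (fun j k => ((2 * r j * r k / (l j + l k) : ℝ) : ℂ)) K) :
    (X * realDiag r * K * realDiag r).trace.re -
        1 / 2 * (X * X * realDiag l).trace.re - 1 / 2 * (K * K * realDiag l).trace.re =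
      -(1 / 4) * weightedSum (fun j k => qfiWeight (l j) (l k)) K := by
  have e1 := trace_mul_self_mul_realDiag hK (fun _ _ => 1) (by simp) l
  have e2 := trace_schur_mul_schur (fun j k => ((2 * r j * r k / (l j + l k) : ℝ) : ℂ))
    (fun _ _ => 1) hK r r
  have e3 := trace_mul_self_mul_realDiag hK (fun j k => ((2 * r j * r k / (l j + l k) : ℝ) : ℂ))
    (fun j k => by simp; ring) l
  rw [schur_one] at e1 e2
  rw [← hX] at e2 e3
  rw [e1, e2, e3, sub_eq_add_neg, sub_eq_add_neg, ← neg_mul, ← neg_mul, weightedSum_mul_left,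
    weightedSum_mul_left, weightedSum_mul_left, weightedSum_add, weightedSum_add]
  refine weightedSum_eq_of_symm_eq hK fun j k => ?_
  simp only [mul_one, Complex.ofReal_re, Complex.normSq_ofReal, Complex.normSq_one, qfiWeight]
  rw [add_comm (l k) (l j)]
  -- If l_j + l_k = 0, both eigenvalues vanish and the convention x/0 = 0 makes both sides zero.
  rcases (add_nonneg (hl j) (hl k)).eq_or_lt with h | h
  · have hj : l j = 0 := by linarith [hl j, hl k]
    have hk : l k = 0 := by linarith [hl j, hl k]
    simp [hj, hk]
  · have hj := hr j
    have hk := hr k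
    rw [← hj, ← hk] at h ⊢
    have hne : r j ^ 2 + r k ^ 2 ≠ 0 := by
      rw [pow_two, pow_two]
      exact h.ne'
    field_simp
    ring

/-- This L minimizes the quadratic coefficient: it solves DL + LD = i(DK - KD) with D = `realDiag
l`, whose right side is the derivative of the state, so L is half the symmetric logarithmic
derivative. Its value agrees with that of the lower bound. -/
theorem qfi_upper_coefficient {K : Matrix (Fin d) (Fin d) ℂ} (hK : K.IsHermitian) {l : Fin d → ℝ}
    (hl : ∀ i, 0 ≤ l i) {L : Matrix (Fin d) (Fin d) ℂ}
    (hL : L = schur (fun j k => Complex.I * (((l j - l k) / (l j + l k) : ℝ) : ℂ)) K) :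
    1 / 2 * ((L * L * realDiag l).trace.re +
        (Complex.I • ((K * realDiag l - realDiag l * K) * L)).trace.re) =
      -(1 / 4) * weightedSum (fun j k => qfiWeight (l j) (l k)) K := by
  have e1 := trace_mul_self_mul_realDiag hK
    (fun j k => Complex.I * (((l j - l k) / (l j + l k) : ℝ) : ℂ))
    (fun j k => by simp; ring) l
  have e2 := trace_schur_mul_schur (fun _ _ => Complex.I)
    (fun j k => Complex.I * (((l j - l k) / (l j + l k) : ℝ) : ℂ)) hK l (fun _ => 1)
  have e3 := trace_schur_mul_schur (fun _ _ => Complex.I)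
    (fun j k => Complex.I * (((l j - l k) / (l j + l k) : ℝ) : ℂ)) hK (fun _ => 1) l
  have hI : schur (fun _ _ => Complex.I) K = Complex.I • K := by ext; simp [schur]
  rw [← hL] at e1 e2 e3
  rw [hI, realDiag_one, mul_one] at e2 e3
  have e4 : (Complex.I • ((K * realDiag l - realDiag l * K) * L)).trace =
      (Complex.I • K * realDiag l * L).trace - (Complex.I • K * L * realDiag l).trace := by
    rw [Matrix.trace_mul_comm (Complex.I • K * L)]
    simp [sub_mul, smul_sub, mul_assoc]
  rw [e4, Complex.sub_re, e1, e2, e3, sub_eq_add_neg, ← neg_one_mul (weightedSum _ K),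
    weightedSum_mul_left, weightedSum_mul_left, weightedSum_add, weightedSum_add,
    weightedSum_mul_left]
  refine weightedSum_eq_of_symm_eq hK fun j k => ?_
  simp only [← mul_assoc, Complex.I_mul_I, neg_mul, one_mul, Complex.neg_re, Complex.ofReal_re,
    map_mul, Complex.normSq_I, Complex.normSq_ofReal, qfiWeight]
  rw [add_comm (l k) (l j)]
  rcases (add_nonneg (hl j) (hl k)).eq_or_lt with h | h
  · have hj : l j = 0 := by linarith [hl j, hl k]
    have hk : l k = 0 := by linarith [hl j, hl k]
    simp [hj, hk]
  · field_simp
    ring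

/-- The test unitary is E e^{iδX}; conjugating the trace by E removes the outer factors. -/
theorem fidelity_lower_bound (E : Matrix.unitaryGroup (Fin d) ℂ) {X : Matrix (Fin d) (Fin d) ℂ}
    (hX : X.IsHermitian) (R : Matrix (Fin d) (Fin d) ℂ) (δ : ℝ) :
    (W (-X) δ * (R * E * R)).trace.re ≤
      traceNorm (R * ((E : Matrix (Fin d) (Fin d) ℂ) * R * (E : Matrix (Fin d) (Fin d) ℂ)ᴴ)) := by
  have hX' : (-X).IsHermitian := hX.neg
  refine le_trans (le_of_eq ?_) (re_trace_unitary_mul_le_traceNorm (E * unitaryW hX' δ) _)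
  refine congrArg Complex.re ?_
  refine Eq.trans (trace_conj E _).symm ?_
  congr 1
  simp [mul_assoc]

/-- The test operators e^{-δL/2} and e^{δL/2} are Hermitian and mutually inverse, and their squares
give the two exponentials. -/
theorem fidelity_upper_bound (E : Matrix.unitaryGroup (Fin d) ℂ) {L : Matrix (Fin d) (Fin d) ℂ}
    (hL : L.IsHermitian) {R D : Matrix (Fin d) (Fin d) ℂ} (hR : Rᴴ = R) (hD : R * R = D) (δ : ℝ) :
    traceNorm (R * ((E : Matrix (Fin d) (Fin d) ℂ) * R * (E : Matrix (Fin d) (Fin d) ℂ)ᴴ)) ≤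
      1 / 2 * ((E * D * (E : Matrix (Fin d) (Fin d) ℂ)ᴴ *
        NormedSpace.exp (δ • -L)).trace.re + (NormedSpace.exp (δ • L) * D).trace.re) := by
  have herm : ∀ t : ℝ, (NormedSpace.exp (t • L))ᴴ = NormedSpace.exp (t • L) := fun t => by
    rw [← Matrix.exp_conjTranspose, Matrix.conjTranspose_smul, hL.eq]; simp
  have hadd : ∀ s t : ℝ, NormedSpace.exp (s • L) * NormedSpace.exp (t • L) =
      NormedSpace.exp ((s + t) • L) := fun s t => by
    rw [← Matrix.exp_add_of_commute _ _ (((Commute.refl L).smul_left _).smul_right _), add_smul]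
  have h := two_mul_traceNorm_mul_le R ((E : Matrix (Fin d) (Fin d) ℂ) * R *
    (E : Matrix (Fin d) (Fin d) ℂ)ᴴ) (NormedSpace.exp ((-(δ / 2)) • L))
    (NormedSpace.exp ((δ / 2) • L)) (by rw [hadd]; simp)
  have e1 : hsSq (R * (NormedSpace.exp ((δ / 2) • L))ᴴ) =
      (NormedSpace.exp (δ • L) * D).trace.re := by
    rw [hsSq, Matrix.conjTranspose_mul, hR, herm, herm]
    calc _ = (NormedSpace.exp ((δ / 2) • L) * (D * NormedSpace.exp ((δ / 2) • L))).trace.re := by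
          rw [← hD]; simp only [mul_assoc]
      _ = _ := by rw [Matrix.trace_mul_comm, mul_assoc, hadd, Matrix.trace_mul_comm, add_halves]
  have e2 : hsSq (((E : Matrix (Fin d) (Fin d) ℂ) * R * (E : Matrix (Fin d) (Fin d) ℂ)ᴴ)ᴴ *
      NormedSpace.exp ((-(δ / 2)) • L)) =
      (E * D * (E : Matrix (Fin d) (Fin d) ℂ)ᴴ * NormedSpace.exp (δ • -L)).trace.re := by
    rw [hsSq, Matrix.conjTranspose_mul, herm, Matrix.conjTranspose_conjTranspose]
    calc _ = (NormedSpace.exp ((-(δ / 2)) • L) * ((E * D * (E : Matrix (Fin d) (Fin d) ℂ)ᴴ) *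
            NormedSpace.exp ((-(δ / 2)) • L))).trace.re := by
          rw [← hD]; simp [mul_assoc, Matrix.conjTranspose_mul, hR]
      _ = _ := by
          rw [Matrix.trace_mul_comm, mul_assoc _ (NormedSpace.exp _), hadd,
            show -(δ / 2) + -(δ / 2) = -δ by ring, neg_smul, smul_neg]
  rw [e1, e2] at h
  linarith

theorem tendsto_qfiQuotient {H : Matrix (Fin d) (Fin d) ℂ} (hH : H.IsHermitian)
    (V : Matrix.unitaryGroup (Fin d) ℂ) {l : Fin d → ℝ} (hl : ∀ i, 0 ≤ l i) (hl1 : ∑ i, l i = 1)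
    (θ : ℝ) :
    Tendsto (qfiQuotient (family H ((V : Matrix (Fin d) (Fin d) ℂ) * realDiag l *
      (V : Matrix (Fin d) (Fin d) ℂ)ᴴ)) θ) (𝓝[≠] 0)
      (𝓝 (2 * weightedSum (fun j k => qfiWeight (l j) (l k))
        ((V : Matrix (Fin d) (Fin d) ℂ)ᴴ * H * (V : Matrix (Fin d) (Fin d) ℂ)))) := by
  obtain ⟨K, hKdef, hK, hF⟩ : ∃ K : Matrix (Fin d) (Fin d) ℂ,
      K = (V : Matrix (Fin d) (Fin d) ℂ)ᴴ * H * (V : Matrix (Fin d) (Fin d) ℂ) ∧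
      ∃ hK : K.IsHermitian, ∀ δ, fidelity
        (family H ((V : Matrix (Fin d) (Fin d) ℂ) * realDiag l *
          (V : Matrix (Fin d) (Fin d) ℂ)ᴴ) θ)
        (family H ((V : Matrix (Fin d) (Fin d) ℂ) * realDiag l *
          (V : Matrix (Fin d) (Fin d) ℂ)ᴴ) (θ + δ)) =
        traceNorm (realDiag (fun i => √(l i)) * ((unitaryW hK δ : Matrix (Fin d) (Fin d) ℂ) *
          realDiag (fun i => √(l i)) * (unitaryW hK δ : Matrix (Fin d) (Fin d) ℂ)ᴴ)) :=
    ⟨_, rfl, isHermitian_conj hH (V : Matrix (Fin d) (Fin d) ℂ), fun δ => by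
      rw [family_conj H hH, family_conj H hH, unitaryW_add_mul hH V θ δ, fidelity_conj _ _ hl]⟩
  rw [← hKdef]
  have hr : ∀ i, √(l i) * √(l i) = l i := fun i => Real.mul_self_sqrt (hl i)
  have hX := isHermitian_schur (s := fun j k => ((2 * √(l j) * √(l k) / (l j + l k) : ℝ) : ℂ))
    (fun j k => by simp; ring) hK
  have hL := isHermitian_schur
    (s := fun j k => Complex.I * (((l j - l k) / (l j + l k) : ℝ) : ℂ))
    (fun j k => by simp; ring) hK
  have h1 := qfi_lower_expansion hK hX l (fun i => √(l i)) hr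
  rw [qfi_lower_coefficient hK hl hr rfl, hl1] at h1
  have h2 := qfi_upper_expansion (L := schur (fun j k =>
    Complex.I * (((l j - l k) / (l j + l k) : ℝ) : ℂ)) K) hK l
  rw [qfi_upper_coefficient hK hl rfl, hl1] at h2
  have e : ∀ x : ℝ, -8 * (-(1 / 4) * x) = 2 * x := fun x => by ring
  have h1 := h1.tendsto_quotient
  have h2 := h2.tendsto_quotient
  rw [e] at h1 h2
  refine tendsto_of_tendsto_of_tendsto_of_le_of_le h2 h1 (fun δ => ?_) (fun δ => ?_)
  · have h := fidelity_upper_bound (unitaryW hK δ) hL (R := realDiag fun i => √(l i))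
      (D := realDiag l) (conjTranspose_realDiag _) (by simp only [realDiag_mul, hr]) δ
    rw [← hF] at h
    exact mul_le_mul_of_nonneg_left
      (div_le_div_of_nonneg_right (sub_le_sub_left h 1) (sq_nonneg δ)) (by norm_num)
  · have h := fidelity_lower_bound (unitaryW hK δ) hX (realDiag fun i => √(l i)) δ
    rw [← hF] at h
    exact mul_le_mul_of_nonneg_left
      (div_le_div_of_nonneg_right (sub_le_sub_left h 1) (sq_nonneg δ)) (by norm_num)

end Limits

/-! ### Von Neumann's trace inequality -/

section TraceInequality

variable {d : ℕ}

/-- By Birkhoff's theorem `M` is a convex combination of permutation matrices, and for each of those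
this is the rearrangement inequality. -/
theorem sum_mul_doublyStochastic_le {M : Matrix (Fin d) (Fin d) ℝ}
    (hM : M ∈ doublyStochastic ℝ (Fin d)) {h k : Fin d → ℝ} (hh : Antitone h) (hk : Antitone k) :
    ∑ i, ∑ j, h i * k j * M i j ≤ ∑ i, h i * k i := by
  obtain ⟨w, hw0, hw1, rfl⟩ := exists_eq_sum_perm_of_mem_doublyStochastic hM
  have hmono : Monovary h k := hh.monovary hk
  calc ∑ i, ∑ j, h i * k j * (∑ σ, w σ • σ.permMatrix ℝ) i j
      = ∑ σ, w σ * ∑ i, h i * k (σ i) := by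
        simp only [Matrix.sum_apply, Matrix.smul_apply, smul_eq_mul, Finset.mul_sum]
        rw [Finset.sum_comm (s := (Finset.univ : Finset (Equiv.Perm (Fin d))))]
        refine Finset.sum_congr rfl fun i _ => ?_
        rw [Finset.sum_comm]
        refine Finset.sum_congr rfl fun σ _ => ?_
        simp [PEquiv.toMatrix_apply, Equiv.toPEquiv_apply]
        ring
    _ ≤ ∑ σ, w σ * ∑ i, h i * k i :=
        Finset.sum_le_sum fun σ _ =>
          mul_le_mul_of_nonneg_left hmono.sum_mul_comp_perm_le_sum_mul (hw0 σ)
    _ = ∑ i, h i * k i := by rw [← Finset.sum_mul, hw1, one_mul]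

theorem normSq_mem_doublyStochastic (X : Matrix.unitaryGroup (Fin d) ℂ) :
    (Matrix.of fun i j => Complex.normSq ((X : Matrix (Fin d) (Fin d) ℂ) i j)) ∈
      doublyStochastic ℝ (Fin d) := by
  rw [mem_doublyStochastic_iff_sum]
  refine ⟨fun i j => Complex.normSq_nonneg _, fun i => ?_, fun j => ?_⟩
  · have := congrArg Complex.re (congrFun (congrFun (unitary_mul_conjTranspose X) i) i)
    simpa [Matrix.mul_apply, Complex.normSq_apply] using this
  · have := congrArg Complex.re (congrFun (congrFun (unitary_conjTranspose_mul X) j) j)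
    simpa [Matrix.mul_apply, Complex.normSq_apply] using this

/-- The trace is Σ h_i k_j |(BᴴC)_ij|², and the squared moduli of a unitary matrix are doubly
stochastic. -/
theorem re_trace_mul_le (B C : Matrix.unitaryGroup (Fin d) ℂ) {h k : Fin d → ℝ} (hh : Antitone h)
    (hk : Antitone k) :
    (((B : Matrix (Fin d) (Fin d) ℂ) * realDiag h * (B : Matrix (Fin d) (Fin d) ℂ)ᴴ) *
      ((C : Matrix (Fin d) (Fin d) ℂ) * realDiag k * (C : Matrix (Fin d) (Fin d) ℂ)ᴴ)).trace.re ≤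
      ∑ i, h i * k i := by
  refine le_trans (le_of_eq ?_)
    (sum_mul_doublyStochastic_le (normSq_mem_doublyStochastic (B⁻¹ * C)) hh hk)
  have h1 := trace_mul_realDiag_mul_realDiag
    ((B : Matrix (Fin d) (Fin d) ℂ)ᴴ * (C : Matrix (Fin d) (Fin d) ℂ))
    ((B : Matrix (Fin d) (Fin d) ℂ)ᴴ * (C : Matrix (Fin d) (Fin d) ℂ))ᴴ k h
  have h2 : ((B⁻¹ * C : Matrix.unitaryGroup (Fin d) ℂ) : Matrix (Fin d) (Fin d) ℂ) =
    (B : Matrix (Fin d) (Fin d) ℂ)ᴴ * (C : Matrix (Fin d) (Fin d) ℂ) := rfl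
  rw [h2]
  have h3 : ((B : Matrix (Fin d) (Fin d) ℂ) * realDiag h * (B : Matrix (Fin d) (Fin d) ℂ)ᴴ *
      ((C : Matrix (Fin d) (Fin d) ℂ) * realDiag k * (C : Matrix (Fin d) (Fin d) ℂ)ᴴ)).trace =
      ((B : Matrix (Fin d) (Fin d) ℂ)ᴴ * (C : Matrix (Fin d) (Fin d) ℂ) * realDiag k *
        ((B : Matrix (Fin d) (Fin d) ℂ)ᴴ * (C : Matrix (Fin d) (Fin d) ℂ))ᴴ * realDiag h).trace := by
    rw [Matrix.trace_mul_comm _ (realDiag h)]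
    refine Eq.trans ?_ (trace_conj B _)
    congr 1
    simp [mul_assoc, Matrix.conjTranspose_mul]
  rw [h3, h1]
  refine Finset.sum_congr rfl fun i _ => Finset.sum_congr rfl fun j _ => ?_
  rw [Matrix.conjTranspose_apply, Matrix.of_apply, mul_comm (k j)]
  simp [Complex.normSq_apply]

/-- The trace inequality for the common matrix bounds its squared norm by Σ k₁k₂, which forces Σ (k₁
- k₂)² ≤ 0. -/
theorem antitone_eigenvalues_unique {C₁ C₂ : Matrix.unitaryGroup (Fin d) ℂ} {k₁ k₂ : Fin d → ℝ}
    (h₁ : Antitone k₁) (h₂ : Antitone k₂)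
    (h : (C₁ : Matrix (Fin d) (Fin d) ℂ) * realDiag k₁ * (C₁ : Matrix (Fin d) (Fin d) ℂ)ᴴ =
      C₂ * realDiag k₂ * (C₂ : Matrix (Fin d) (Fin d) ℂ)ᴴ) : k₁ = k₂ := by
  have e := re_trace_mul_le C₁ C₂ h₁ h₂
  have e1 : (((C₁ : Matrix (Fin d) (Fin d) ℂ) * realDiag k₁ * (C₁ : Matrix (Fin d) (Fin d) ℂ)ᴴ) *
      ((C₁ : Matrix (Fin d) (Fin d) ℂ) * realDiag k₁ *
        (C₁ : Matrix (Fin d) (Fin d) ℂ)ᴴ)).trace.re = ∑ i, k₁ i * k₁ i := by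
    rw [conj_realDiag_mul_conj, trace_conj, trace_realDiag]
  have e2 : (((C₂ : Matrix (Fin d) (Fin d) ℂ) * realDiag k₂ * (C₂ : Matrix (Fin d) (Fin d) ℂ)ᴴ) *
      ((C₂ : Matrix (Fin d) (Fin d) ℂ) * realDiag k₂ *
        (C₂ : Matrix (Fin d) (Fin d) ℂ)ᴴ)).trace.re = ∑ i, k₂ i * k₂ i := by
    rw [conj_realDiag_mul_conj, trace_conj, trace_realDiag]
  rw [h] at e e1
  have e3 : ∑ i, (k₁ i - k₂ i) ^ 2 ≤ 0 := by
    have : ∑ i, (k₁ i - k₂ i) ^ 2 =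
        ∑ i, k₁ i * k₁ i + ∑ i, k₂ i * k₂ i - 2 * ∑ i, k₁ i * k₂ i := by
      rw [Finset.mul_sum, ← Finset.sum_add_distrib, ← Finset.sum_sub_distrib]
      exact Finset.sum_congr rfl fun i _ => by ring
    linarith
  have e4 := (Finset.sum_eq_zero_iff_of_nonneg fun i _ => sq_nonneg (k₁ i - k₂ i)).mp
    (le_antisymm e3 (Finset.sum_nonneg fun i _ => sq_nonneg _))
  funext i
  have := pow_eq_zero_iff (two_ne_zero) |>.mp (e4 i (Finset.mem_univ i))
  linarith

end TraceInequality

/-! ### The sharp bound on off-diagonal blocks -/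

section BlockInequality

variable {d : ℕ}

theorem rank_add_le_rank (A B : Matrix (Fin d) (Fin d) ℂ) : (A + B).rank ≤ A.rank + B.rank := by
  rw [Matrix.rank, Matrix.rank, Matrix.rank]
  refine le_trans (Submodule.finrank_mono ?_) (Submodule.finrank_add_le_finrank_add_finrank _ _)
  rintro _ ⟨x, rfl⟩
  rw [Matrix.mulVecLin_add]
  exact Submodule.add_mem_sup ⟨x, rfl⟩ ⟨x, rfl⟩

/-- With P the coordinate projection onto S, such an N equals PN + NP, and each term has rank at
most |S|. -/
theorem rank_le_two_mul_card (N : Matrix (Fin d) (Fin d) ℂ) (S : Finset (Fin d))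
    (hN : ∀ j k, N j k ≠ 0 → (j ∈ S ∧ k ∉ S) ∨ (j ∉ S ∧ k ∈ S)) : N.rank ≤ 2 * S.card := by
  classical
  let P : Matrix (Fin d) (Fin d) ℂ := Matrix.diagonal fun j => if j ∈ S then 1 else 0
  have hP : P.rank = S.card := by
    rw [Matrix.rank_diagonal, Fintype.card_subtype]
    congr 1
    ext j
    simp
  have e : N = P * N + N * P := by
    ext j k
    simp only [P, Matrix.add_apply, Matrix.diagonal_mul, Matrix.mul_diagonal]
    by_cases h : N j k = 0
    · simp [h]
    · rcases hN j k h with ⟨h1, h2⟩ | ⟨h1, h2⟩ <;> simp [h1, h2]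
  calc N.rank = (P * N + N * P).rank := by rw [← e]
    _ ≤ (P * N).rank + (N * P).rank := rank_add_le_rank _ _
    _ ≤ P.rank + P.rank := add_le_add (Matrix.rank_mul_le_left _ _) (Matrix.rank_mul_le_right _ _)
    _ = 2 * S.card := by rw [hP]; ring

theorem rank_conj_realDiag (C : Matrix.unitaryGroup (Fin d) ℂ) (k : Fin d → ℝ) :
    ((C : Matrix (Fin d) (Fin d) ℂ) * realDiag k * (C : Matrix (Fin d) (Fin d) ℂ)ᴴ).rank =
      (Finset.univ.filter fun i => k i ≠ 0).card := by
  have h1 : IsUnit (C : Matrix (Fin d) (Fin d) ℂ).det :=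
    (Matrix.isUnit_iff_isUnit_det _).mp ⟨⟨C, (C : Matrix (Fin d) (Fin d) ℂ)ᴴ, by simp, by simp⟩, rfl⟩
  have h2 : IsUnit (C : Matrix (Fin d) (Fin d) ℂ)ᴴ.det :=
    (Matrix.isUnit_iff_isUnit_det _).mp ⟨⟨(C : Matrix (Fin d) (Fin d) ℂ)ᴴ, C, by simp, by simp⟩, rfl⟩
  rw [Matrix.rank_mul_eq_left_of_isUnit_det _ _ h2, Matrix.rank_mul_eq_right_of_isUnit_det _ _ h1,
    realDiag, Matrix.rank_diagonal, Fintype.card_subtype]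
  congr 1
  ext i
  simp

/-- The coupling of the first `m` basis vectors with those from index `n` on. -/
def blockWeight (m n : ℕ) (j k : Fin d) : ℝ := if (j : ℕ) < m ∧ n ≤ (k : ℕ) then 1 else 0

/-- If k_i > 0, the indices up to `i` and their reflections are disjoint and all carry nonzero
values, so 2(i + 1) ≤ 2s. -/
theorem lt_of_odd_antitone_pos {k : Fin d → ℝ} (hk : Antitone k) (hodd : ∀ i, k i.rev = -k i)
    {s : ℕ} (hs : (Finset.univ.filter fun i => k i ≠ 0).card ≤ 2 * s) {i : Fin d} (hi : 0 < k i) :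
    (i : ℕ) < s := by
  have hlt : i < i.rev := by
    by_contra hcon
    have := hk (not_lt.mp hcon)
    rw [hodd] at this
    linarith
  have hdisj : Disjoint (Finset.Iic i) ((Finset.Iic i).map Fin.revPerm.toEmbedding) := by
    rw [Finset.disjoint_left]
    intro a ha hb
    simp only [Finset.mem_map, Finset.mem_Iic, Equiv.coe_toEmbedding, Fin.revPerm_apply] at ha hb
    obtain ⟨b, hb, rfl⟩ := hb
    have h1 : i.rev ≤ b.rev := Fin.rev_le_rev.mpr hb
    exact absurd (h1.trans ha) (not_le.mpr hlt)
  have hsub : (Finset.Iic i) ∪ ((Finset.Iic i).map Fin.revPerm.toEmbedding) ⊆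
      Finset.univ.filter fun i => k i ≠ 0 := by
    intro a ha
    simp only [Finset.mem_union, Finset.mem_map, Finset.mem_Iic, Equiv.coe_toEmbedding,
      Fin.revPerm_apply] at ha
    simp only [Finset.mem_filter, Finset.mem_univ, true_and]
    rcases ha with ha | ⟨b, hb, rfl⟩
    · exact (hi.trans_le (hk ha)).ne'
    · rw [hodd]
      exact neg_ne_zero.mpr (hi.trans_le (hk hb)).ne'
  have h := (Finset.card_le_card hsub).trans hs
  rw [Finset.card_union_of_disjoint hdisj, Finset.card_map, Fin.card_Iic] at h
  omega

/-- Let S be the block sum, T the right side and N the Hermitian matrix made of the block and its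
adjoint. Then 2S = Tr(KN) = Tr(N²) = Σ k_i² for the eigenvalues k of N. Oddness of k, the trace
inequality and (h_i - h_{rev i}) k_i ≤ k_i² + (h_i - h_{rev i})²/4 give 2S ≤ S + T; the rank bound
confines the nonzero k_i to the indices counted by T and their reflections. -/
theorem weightedSum_blockWeight_le {K : Matrix (Fin d) (Fin d) ℂ}
    (B : Matrix.unitaryGroup (Fin d) ℂ) {h : Fin d → ℝ} (hh : Antitone h)
    (hKB : K = B * realDiag h * (B : Matrix (Fin d) (Fin d) ℂ)ᴴ) {m n : ℕ} (hmn : m ≤ n) :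
    weightedSum (blockWeight m n) K ≤
      ∑ i : Fin d, blockWeight m n i i.rev * ((h i - h i.rev) ^ 2 / 4) := by
  have hK : K.IsHermitian := by
    rw [Matrix.IsHermitian, hKB]
    simp [Matrix.conjTranspose_mul, mul_assoc]
  let s : Fin d → Fin d → ℝ := fun j k => blockWeight m n j k + blockWeight m n k j
  have hs : ∀ j k, s j k = s k j := fun j k => add_comm _ _
  -- As m ≤ n, the block and its transpose are disjoint, so `s` takes only the values 0 and 1.
  have hss : ∀ j k, s j k * s j k = s j k := fun j k => by
    simp only [s, blockWeight]
    split_ifs <;> first | omega | norm_num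
  obtain ⟨N, hN⟩ : ∃ N, N = schur (fun j k => (s j k : ℂ)) K := ⟨_, rfl⟩
  have hNh : N.IsHermitian := hN ▸ isHermitian_schur (fun j k => by simp [hs j k]) hK
  obtain ⟨C, k, hC, hk⟩ := exists_unitary_realDiag hNh
  -- conjugation by a reflection turns `N` into `-N`
  let ε : Fin d → ℝ := fun i => if n ≤ (i : ℕ) then -1 else 1
  have hεε : realDiag ε * realDiag ε = 1 := by
    rw [realDiag_mul, ← realDiag_one]
    congr 1
    funext i
    simp only [ε]
    split_ifs <;> norm_num
  let R : Matrix.unitaryGroup (Fin d) ℂ := ⟨realDiag ε, by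
    rw [Matrix.mem_unitaryGroup_iff, Matrix.star_eq_conjTranspose, conjTranspose_realDiag, hεε]⟩
  have hRN : realDiag ε * N * realDiag ε = -N := by
    ext i j
    rw [realDiag, Matrix.mul_diagonal, Matrix.diagonal_mul, hN]
    simp only [schur, Matrix.of_apply, Matrix.neg_apply, s, blockWeight, ε]
    split_ifs <;> first | omega | (push_cast; ring)
  -- N = -RNR also has the eigenvalues -k, whose reversal is decreasing; uniqueness of the ordered
  -- spectrum identifies it with k.
  have hodd : ∀ i, k i.rev = -k i := by
    obtain ⟨C', hC'⟩ := exists_unitary_comp_perm (R * C) (fun i => -k i) Fin.revPerm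
    have e : (C : Matrix (Fin d) (Fin d) ℂ) * realDiag k * (C : Matrix (Fin d) (Fin d) ℂ)ᴴ =
        C' * realDiag ((fun i => -k i) ∘ Fin.revPerm) * (C' : Matrix (Fin d) (Fin d) ℂ)ᴴ := by
      rw [← hC', ← hC]
      have e1 : realDiag (fun i => -k i) = -realDiag k := by
        ext i j
        simp [realDiag, Matrix.diagonal_apply]
        split_ifs <;> simp
      calc N = -(realDiag ε * N * realDiag ε) := by rw [hRN, neg_neg]
        _ = _ := by
          rw [e1, hC]
          simp [R, mul_assoc, Matrix.conjTranspose_mul]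
    have e2 := antitone_eigenvalues_unique hk (fun i j hij => by
      simpa using hk (Fin.rev_le_rev.mpr hij)) e
    intro i
    have := congrFun e2 i
    simp only [Function.comp, Fin.revPerm_apply] at this
    linarith
  have hrank := rank_conj_realDiag C k
  rw [← hC] at hrank
  -- The rank bound is applied to the rows and to the columns of the block: it gives i < m and i < d
  -- - n, the latter meaning n ≤ rev i.
  have hT : ∀ i, 0 < k i → blockWeight m n i i.rev = 1 := by
    intro i hi
    have h1 : (i : ℕ) < (Finset.univ.filter fun i : Fin d => (i : ℕ) < m).card :=
      lt_of_odd_antitone_pos hk hodd (hrank ▸ rank_le_two_mul_card N _ fun j k hjk => by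
        simp only [Finset.mem_filter, Finset.mem_univ, true_and]
        by_contra hcon
        apply hjk
        rw [hN]
        simp only [schur, Matrix.of_apply, s, blockWeight]
        rw [if_neg (by omega), if_neg (by omega)]
        simp) hi
    have h2 : (i : ℕ) < (Finset.univ.filter fun i : Fin d => n ≤ (i : ℕ)).card :=
      lt_of_odd_antitone_pos hk hodd (hrank ▸ rank_le_two_mul_card N _ fun j k hjk => by
        simp only [Finset.mem_filter, Finset.mem_univ, true_and]
        by_contra hcon
        apply hjk
        rw [hN]
        simp only [schur, Matrix.of_apply, s, blockWeight]
        rw [if_neg (by omega), if_neg (by omega)]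
        simp) hi
    have c1 : (Finset.univ.filter fun i : Fin d => (i : ℕ) < m).card ≤ m := by
      rw [Fin.card_filter_val_lt]
      exact min_le_right _ _
    have c2 : (Finset.univ.filter fun i : Fin d => n ≤ (i : ℕ)).card ≤ d - n := by
      have := Finset.card_filter_add_card_filter_not (s := (Finset.univ : Finset (Fin d)))
        (fun i => (i : ℕ) < n)
      simp only [Fin.card_filter_val_lt, not_lt, Finset.card_univ, Fintype.card_fin] at this
      omega
    rw [blockWeight, if_pos]
    refine ⟨by omega, ?_⟩
    rw [Fin.val_rev]
    omega
  have t1 : (K * N).trace.re = 2 * weightedSum (blockWeight m n) K := by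
    have := trace_schur_mul_schur (fun _ _ => 1) (fun j k => (s j k : ℂ)) hK (fun _ => 1)
      (fun _ => 1)
    rw [schur_one, ← hN, realDiag_one, mul_one, mul_one] at this
    rw [this, weightedSum_mul_left]
    refine weightedSum_eq_of_symm_eq hK fun j k => ?_
    simp [s]
    ring
  have t2 : (N * N).trace.re = 2 * weightedSum (blockWeight m n) K := by
    have := trace_schur_mul_schur (fun j k => (s j k : ℂ)) (fun j k => (s j k : ℂ)) hK (fun _ => 1)
      (fun _ => 1)
    rw [← hN, realDiag_one, mul_one, mul_one] at this
    rw [this, weightedSum_mul_left]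
    refine weightedSum_eq_of_symm_eq hK fun j k => ?_
    rw [hs k j, ← Complex.ofReal_mul, Complex.ofReal_re, hss]
    simp [s]
    ring
  have t3 : (N * N).trace.re = ∑ i, k i * k i := by
    rw [hC, conj_realDiag_mul_conj, trace_conj, trace_realDiag]
  have t4 : (K * N).trace.re ≤ ∑ i, h i * k i := by
    rw [hKB, hC]
    exact re_trace_mul_le B C hh hk
  have hrev : ∀ f : Fin d → ℝ, ∑ i, f (Fin.rev i) = ∑ i, f i := fun f =>
    Equiv.sum_comp Fin.revPerm f
  have t5 : 2 * ∑ i, h i * k i = ∑ i, (h i - h i.rev) * k i := by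
    have e := hrev fun i => h i * k i
    simp only [sub_mul, Finset.sum_sub_distrib]
    simp only [hodd, mul_neg, Finset.sum_neg_distrib] at e
    linarith
  have t6 : ∑ i, (h i - h i.rev) * k i ≤ ∑ i, (k i * k i +
      (blockWeight m n i i.rev * ((h i - h i.rev) ^ 2 / 4) +
        blockWeight m n i.rev i.rev.rev * ((h i.rev - h i.rev.rev) ^ 2 / 4))) := by
    refine Finset.sum_le_sum fun i _ => ?_
    have hb : ∀ j k : Fin d, 0 ≤ blockWeight m n j k := fun j k => by
      rw [blockWeight]; split_ifs <;> norm_num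
    have hb1 := mul_nonneg (hb i i.rev) (by positivity : 0 ≤ (h i - h i.rev) ^ 2 / 4)
    have hb2 := mul_nonneg (hb i.rev i.rev.rev)
      (by positivity : 0 ≤ (h i.rev - h i.rev.rev) ^ 2 / 4)
    rcases lt_trichotomy (k i) 0 with h0 | h0 | h0
    -- For k_i < 0 the partner eigenvalue is positive, so it is the reflected summand that supplies
    -- the square.
    · have := hT i.rev (by rw [hodd]; linarith)
      rw [this]
      rw [Fin.rev_rev]
      nlinarith [sq_nonneg (k i - (h i - h i.rev) / 2)]
    · rw [h0]
      linarith
    · have := hT i h0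
      rw [this] at hb1 ⊢
      nlinarith [sq_nonneg (k i - (h i - h i.rev) / 2)]
  rw [Finset.sum_add_distrib, Finset.sum_add_distrib,
    hrev fun i => blockWeight m n i i.rev * ((h i - h i.rev) ^ 2 / 4)] at t6
  linarith

end BlockInequality

/-! ### Summation by parts and the signs of the block coefficients -/

section Weights

variable {d : ℕ}

/-- The part of the array `g (a j) (a k)` on and above the diagonal. -/
def upperWeight (g : ℝ → ℝ → ℝ) (a : ℕ → ℝ) (j k : ℕ) : ℝ := if j ≤ k then g (a j) (a k) else 0

/-- The mixed second difference of `upperWeight`. -/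
def blockCoeff (g : ℝ → ℝ → ℝ) (a : ℕ → ℝ) (m n : ℕ) : ℝ :=
  upperWeight g a m (n + 1) - upperWeight g a (m + 1) (n + 1) - upperWeight g a m n +
    upperWeight g a (m + 1) n

theorem sum_range_ite_lt_sub (u : ℕ → ℝ) (D k : ℕ) :
    ∑ n ∈ Finset.range D, (if n < k then u (n + 1) - u n else 0) = u (min D k) - u 0 := by
  induction D with
  | zero => simp
  | succ D ih =>
    rw [Finset.sum_range_succ, ih]
    split_ifs with h
    · rw [min_eq_left h.le, min_eq_left (Nat.succ_le_of_lt h)]; ring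
    · rw [min_eq_right (not_lt.mp h), min_eq_right (by omega)]; ring

theorem sum_range_ite_le_sub (v : ℕ → ℝ) (D j : ℕ) :
    ∑ m ∈ Finset.range D, (if j ≤ m then v m - v (m + 1) else 0) = v (min j D) - v D := by
  induction D with
  | zero => simp
  | succ D ih =>
    rw [Finset.sum_range_succ, ih]
    split_ifs with h
    · rw [min_eq_left h, min_eq_left (by omega)]; ring
    · rw [min_eq_right (by omega), min_eq_right (by omega)]; ring

/-- Two telescoping sums, over columns and then rows. The boundary terms vanish: column 0 because `g
x x = 0`, row `d` because it lies below the diagonal. -/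
theorem upperWeight_eq_sum {g : ℝ → ℝ → ℝ} (hg : ∀ x, g x x = 0) (a : ℕ → ℝ) (j k : Fin d) :
    upperWeight g a j k = ∑ m ∈ Finset.range d, ∑ n ∈ Finset.range d,
      blockCoeff g a m n * blockWeight (m + 1) (n + 1) j k := by
  have h0 : ∀ m, upperWeight g a m 0 = 0 := fun m => by
    rw [upperWeight]
    split_ifs with h
    · rw [Nat.le_zero.mp h, hg]
    · rfl
  have h1 : ∀ m, ∑ n ∈ Finset.range d, blockCoeff g a m n * blockWeight (m + 1) (n + 1) j k =
      if (j : ℕ) ≤ m then upperWeight g a m k - upperWeight g a (m + 1) k else 0 := fun m => by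
    have e := sum_range_ite_lt_sub
      (fun n => upperWeight g a m n - upperWeight g a (m + 1) n) d k
    rw [min_eq_right k.2.le, h0, h0, sub_zero, sub_zero] at e
    split_ifs with h
    · rw [← e]
      refine Finset.sum_congr rfl fun n _ => ?_
      by_cases hn : n < k
      · rw [blockWeight, if_pos ⟨by omega, by omega⟩, if_pos hn, blockCoeff]
        ring
      · rw [blockWeight, if_neg (by omega), if_neg hn, mul_zero]
    · refine Finset.sum_eq_zero fun n _ => ?_
      rw [blockWeight, if_neg (by omega), mul_zero]
  simp only [h1]
  rw [sum_range_ite_le_sub (fun m => upperWeight g a m k), min_eq_left j.2.le]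
  have : upperWeight g a d k = 0 := by
    rw [upperWeight, if_neg (by omega)]
  rw [this, sub_zero]

/-- Extension of a finite sequence by zero. -/
def extendZero (l : Fin d → ℝ) (i : ℕ) : ℝ := if h : i < d then l ⟨i, h⟩ else 0

theorem extendZero_coe (l : Fin d → ℝ) (i : Fin d) : extendZero l i = l i := by
  simp [extendZero]

theorem extendZero_nonneg {l : Fin d → ℝ} (hl : ∀ i, 0 ≤ l i) (i : ℕ) : 0 ≤ extendZero l i := by
  rw [extendZero]
  split_ifs
  · exact hl _
  · exact le_rfl

theorem extendZero_antitone {l : Fin d → ℝ} (hl : ∀ i, 0 ≤ l i) (ha : Antitone l) :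
    Antitone (extendZero l) := by
  intro i j hij
  by_cases hj : j < d
  · rw [extendZero, extendZero, dif_pos hj, dif_pos (hij.trans_lt hj)]
    exact ha hij
  · rw [extendZero, dif_neg hj]
    exact extendZero_nonneg hl i

/-- The padding of `l` by zero does not affect the sum: the value at index `d` enters only
coefficients that vanish or multiply an empty block. -/
theorem weightedSum_eq_sum_blockCoeff {g : ℝ → ℝ → ℝ} (hg : ∀ x, g x x = 0)
    (hsymm : ∀ x y, g x y = g y x) (l : Fin d → ℝ) {K : Matrix (Fin d) (Fin d) ℂ}
    (hK : K.IsHermitian) :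
    weightedSum (fun j k => g (l j) (l k)) K =
      2 * ∑ p ∈ Finset.range d ×ˢ Finset.range d, blockCoeff g (extendZero l) p.1 p.2 *
        weightedSum (blockWeight (p.1 + 1) (p.2 + 1)) K := by
  have h1 : weightedSum (fun j k => g (l j) (l k)) K =
      weightedSum (fun j k => 2 * upperWeight g (extendZero l) j k) K := by
    refine weightedSum_eq_of_symm_eq hK fun j k => ?_
    simp only [upperWeight, extendZero_coe]
    rw [hsymm (l k) (l j)]
    rcases lt_trichotomy (j : ℕ) k with h | h | h
    · rw [if_pos h.le, if_neg (by omega)]; ring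
    · have : j = k := Fin.ext h
      subst this
      simp [hg]
    · rw [if_neg (by omega), if_pos h.le]; ring
  rw [h1, ← weightedSum_mul_left]
  congr 1
  have h2 : ∀ j k : Fin d, upperWeight g (extendZero l) j k =
      ∑ p ∈ Finset.range d ×ˢ Finset.range d,
        blockCoeff g (extendZero l) p.1 p.2 * blockWeight (p.1 + 1) (p.2 + 1) j k := fun j k => by
    rw [upperWeight_eq_sum hg, Finset.sum_product]
  simp only [weightedSum, h2, Finset.mul_sum, Finset.sum_mul]
  rw [Finset.sum_comm (s := Finset.range d ×ˢ Finset.range d)]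
  refine Finset.sum_congr rfl fun j _ => ?_
  rw [Finset.sum_comm (s := Finset.range d ×ˢ Finset.range d)]
  exact Finset.sum_congr rfl fun k _ => Finset.sum_congr rfl fun p _ => mul_assoc _ _ _

theorem blockCoeff_of_lt {g : ℝ → ℝ → ℝ} (hg : ∀ x, g x x = 0) (a : ℕ → ℝ) {m n : ℕ} (h : n < m) :
    blockCoeff g a m n = 0 := by
  simp only [blockCoeff, upperWeight]
  rw [if_neg (by omega : ¬ m + 1 ≤ n + 1), if_neg (by omega : ¬ m ≤ n),
    if_neg (by omega : ¬ m + 1 ≤ n)]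
  split_ifs with h1
  · rw [show m = n + 1 by omega, hg]; ring
  · ring

theorem blockCoeff_self {g : ℝ → ℝ → ℝ} (hg : ∀ x, g x x = 0) (a : ℕ → ℝ) (m : ℕ) :
    blockCoeff g a m m = g (a m) (a (m + 1)) := by
  simp [blockCoeff, upperWeight, hg]

theorem blockCoeff_of_gt (g : ℝ → ℝ → ℝ) (a : ℕ → ℝ) {m n : ℕ} (h : m < n) :
    blockCoeff g a m n = g (a m) (a (n + 1)) - g (a (m + 1)) (a (n + 1)) - g (a m) (a n) +
      g (a (m + 1)) (a n) := by
  simp only [blockCoeff, upperWeight]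
  rw [if_pos (by omega), if_pos (by omega), if_pos (by omega), if_pos (by omega)]

/-- Two consecutive gaps of the sequence at which the block coefficients are positive. -/
def IsGapPair (a : ℕ → ℝ) (m n : ℕ) : Prop := m ≤ n ∧ a (m + 1) < a m ∧ a (n + 1) < a n

/-- On the diagonal the coefficient is g(a_m, a_{m+1}), above it a mixed difference over two gaps,
below it zero. It also vanishes as soon as one of the two gaps closes, so strict positivity of `g`
and of its mixed differences locates the support exactly. -/
theorem blockCoeff_sign {g : ℝ → ℝ → ℝ} (hg : ∀ x, g x x = 0)
    (hdiag : ∀ x y, 0 ≤ y → y < x → 0 < g x y)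
    (hoff : ∀ x y z w, 0 ≤ w → w < z → z ≤ y → y < x → 0 < g x w - g y w - g x z + g y z)
    {a : ℕ → ℝ} (ha : Antitone a) (ha0 : ∀ i, 0 ≤ a i) (m n : ℕ) :
    0 ≤ blockCoeff g a m n ∧ (0 < blockCoeff g a m n ↔ IsGapPair a m n) := by
  rcases lt_trichotomy m n with h | h | h
  · rw [blockCoeff_of_gt g a h]
    rcases (ha (Nat.le_succ m)).eq_or_lt with hm | hm
    · simp [IsGapPair, hm]
    rcases (ha (Nat.le_succ n)).eq_or_lt with hn | hn
    · simp [IsGapPair, hn]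
    have := hoff _ _ _ _ (ha0 (n + 1)) hn (ha (Nat.succ_le_of_lt h)) hm
    exact ⟨this.le, fun _ => ⟨h.le, hm, hn⟩, fun _ => this⟩
  · subst h
    rw [blockCoeff_self hg]
    rcases (ha (Nat.le_succ m)).eq_or_lt with hm | hm
    · simp [IsGapPair, hm, hg]
    · have := hdiag _ _ (ha0 (m + 1)) hm
      exact ⟨this.le, fun _ => ⟨le_rfl, hm, hm⟩, fun _ => this⟩
  · rw [blockCoeff_of_lt hg a h]
    simp [IsGapPair, h]

theorem qfiWeight_self (x : ℝ) : qfiWeight x x = 0 := by simp [qfiWeight]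

theorem qfiWeight_comm (x y : ℝ) : qfiWeight x y = qfiWeight y x := by
  rw [qfiWeight, qfiWeight, add_comm]
  congr 1
  ring

theorem qfiBlockCoeff_sign {a : ℕ → ℝ} (ha : Antitone a) (ha0 : ∀ i, 0 ≤ a i) (m n : ℕ) :
    0 ≤ blockCoeff qfiWeight a m n ∧ (0 < blockCoeff qfiWeight a m n ↔ IsGapPair a m n) := by
  refine blockCoeff_sign qfiWeight_self (fun x y hy hxy => ?_)
    (fun x y z w hw hwz hzy hyx => ?_) ha ha0 m n
  · exact div_pos (pow_pos (by linarith) 2) (by linarith)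
  · have hz : 0 < z := by linarith
    have hy : 0 < y := by linarith
    have hx : 0 < x := by linarith
    have e : qfiWeight x w - qfiWeight y w - qfiWeight x z + qfiWeight y z =
        4 * (x - y) * (z - w) * (x * y * (z + w) + z * w * (x + y)) /
          ((x + z) * (y + z) * (x + w) * (y + w)) := by
      have h1 : x + w ≠ 0 := by positivity
      have h2 : y + w ≠ 0 := by positivity
      have h3 : x + z ≠ 0 := by positivity
      have h4 : y + z ≠ 0 := by positivity
      simp only [qfiWeight]
      field_simp
      ring
    rw [e]
    have h1 : 0 < x - y := by linarith
    have h2 : 0 < z - w := by linarith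
    positivity

theorem subQfiBlockCoeff_sign {a : ℕ → ℝ} (ha : Antitone a) (ha0 : ∀ i, 0 ≤ a i) (m n : ℕ) :
    0 ≤ blockCoeff (fun x y => (x - y) ^ 2) a m n ∧
      (0 < blockCoeff (fun x y => (x - y) ^ 2) a m n ↔ IsGapPair a m n) := by
  refine blockCoeff_sign (fun x => by simp) (fun x y hy hxy => ?_)
    (fun x y z w hw hwz hzy hyx => ?_) ha ha0 m n
  · exact pow_pos (by linarith) 2
  · have : 0 < (x - y) * (z - w) := mul_pos (by linarith) (by linarith)
    nlinarith

/-- A nonnegative combination of functions with a common maximizer `x₀` is maximal at `x` exactly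
if each function with a positive coefficient is. -/
theorem forall_sum_mul_le_iff {X I : Type*} (s : Finset I) {c : I → ℝ} (hc : ∀ i, 0 ≤ c i)
    (B : X → I → ℝ) (x₀ : X) (hB : ∀ i, 0 < c i → ∀ x, B x i ≤ B x₀ i) (x : X) :
    (∀ y, ∑ i ∈ s, c i * B y i ≤ ∑ i ∈ s, c i * B x i) ↔
      ∀ i ∈ s, 0 < c i → B x i = B x₀ i := by
  have hle : ∀ y, ∀ i ∈ s, c i * B y i ≤ c i * B x₀ i := fun y i _ => by
    rcases (hc i).eq_or_lt with h | h
    · simp [← h]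
    · exact mul_le_mul_of_nonneg_left (hB i h y) h.le
  constructor
  · intro h i hi hpos
    have e := (Finset.sum_eq_sum_iff_of_le (hle x)).mp
      (le_antisymm (Finset.sum_le_sum (hle x)) (h x₀)) i hi
    exact mul_left_cancel₀ hpos.ne' e
  · intro h y
    refine (Finset.sum_le_sum (hle y)).trans (le_of_eq (Finset.sum_congr rfl fun i hi => ?_))
    rcases (hc i).eq_or_lt with h0 | h0
    · simp [← h0]
    · rw [h i hi h0]

end Weights

/-! ### The optimal vectors -/

section Optimal

variable {d : ℕ}

/-- The matrix with columns `v j`. -/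
def columns (v : Fin d → EuclideanSpace ℂ (Fin d)) : Matrix (Fin d) (Fin d) ℂ :=
  Matrix.of fun i j => (v j) i

theorem spectralSum_eq (l : Fin d → ℝ) (v : Fin d → EuclideanSpace ℂ (Fin d)) :
    spectralSum l v = columns v * realDiag l * (columns v)ᴴ := by
  ext i k
  rw [spectralSum, Matrix.sum_apply, Matrix.mul_apply]
  refine Finset.sum_congr rfl fun j _ => ?_
  rw [realDiag, Matrix.mul_diagonal]
  simp [columns, Matrix.vecMulVec_apply]
  ring

theorem columns_mem_unitaryGroup (b : OrthonormalBasis (Fin d) ℂ (EuclideanSpace ℂ (Fin d))) :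
    columns b ∈ Matrix.unitaryGroup (Fin d) ℂ := by
  rw [Matrix.mem_unitaryGroup_iff']
  ext j k
  have h := orthonormal_iff_ite.mp b.orthonormal j k
  rw [Matrix.one_apply, ← h]
  simp [Matrix.mul_apply, columns, PiLp.inner_apply, mul_comm]

/-- The coefficient of `b j` in `optVec b χ j`. -/
noncomputable def optCoeff (j : Fin d) : ℝ := if j = j.rev then 1 else 1 / √2

/-- The coefficient of `b j.rev` in `optVec b χ j`. -/
noncomputable def optCoeffRev (χ : ℝ) (j : Fin d) : ℂ :=
  if j < j.rev then ((1 / √2 : ℝ) : ℂ) * Complex.exp (Complex.I * (χ : ℂ))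
  else if j = j.rev then 0
  else -(((1 / √2 : ℝ) : ℂ) * Complex.exp (-(Complex.I * (χ : ℂ))))

/-- The matrix of the optimal vectors in the eigenbasis of the generator. -/
noncomputable def optMatrix (d : ℕ) (χ : ℝ) : Matrix (Fin d) (Fin d) ℂ :=
  Matrix.of fun i j => (optCoeff j : ℂ) * (if i = j then 1 else 0) +
    optCoeffRev χ j * (if i = j.rev then 1 else 0)

theorem columns_optVec (b : Fin d → EuclideanSpace ℂ (Fin d)) (χ : ℝ) :
    columns (optVec b χ) = columns b * optMatrix d χ := by
  ext i j
  rw [Matrix.mul_apply]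
  have e : ∑ k, columns b i k * optMatrix d χ k j =
      (optCoeff j : ℂ) * b j i + optCoeffRev χ j * b j.rev i := by
    simp only [columns, optMatrix, Matrix.of_apply, mul_add, Finset.sum_add_distrib]
    simp
    ring
  rw [e]
  simp only [columns, Matrix.of_apply, optVec, optCoeff, optCoeffRev]
  split_ifs with h1 h2 h3
  · exact absurd h1 (h2 ▸ lt_irrefl _)
  · simp
    ring
  · simp
  · simp
    ring

theorem star_exp_I_mul (χ : ℝ) :
    (starRingEnd ℂ) (Complex.exp (Complex.I * χ)) = Complex.exp (-(Complex.I * χ)) := by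
  rw [← Complex.exp_conj]
  simp

theorem star_exp_neg_I_mul (χ : ℝ) :
    (starRingEnd ℂ) (Complex.exp (-(Complex.I * χ))) = Complex.exp (Complex.I * χ) := by
  rw [← Complex.exp_conj]
  simp

theorem normSq_exp_I_mul (χ : ℝ) : Complex.normSq (Complex.exp (Complex.I * χ)) = 1 := by
  rw [Complex.normSq_eq_norm_sq, mul_comm, Complex.norm_exp_ofReal_mul_I, one_pow]

theorem normSq_exp_neg_I_mul (χ : ℝ) : Complex.normSq (Complex.exp (-(Complex.I * χ))) = 1 := by
  rw [← star_exp_I_mul, Complex.normSq_conj, normSq_exp_I_mul]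

theorem ofReal_inv_sqrt_two_mul_self : (((1 / √2 : ℝ) : ℂ)) * ((1 / √2 : ℝ) : ℂ) = 1 / 2 := by
  rw [← Complex.ofReal_mul, div_mul_div_comm, Real.mul_self_sqrt (by norm_num)]
  push_cast
  ring

theorem optMatrix_conj_apply (χ : ℝ) (h : Fin d → ℝ) (j k : Fin d) :
    ((optMatrix d χ)ᴴ * realDiag h * optMatrix d χ) j k =
      (optCoeff j : ℂ) * h j * optMatrix d χ j k +
        (starRingEnd ℂ) (optCoeffRev χ j) * h j.rev * optMatrix d χ j.rev k := by
  rw [Matrix.mul_apply]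
  have e : ∀ i, ((optMatrix d χ)ᴴ * realDiag h) j i =
      (optCoeff j : ℂ) * h i * (if i = j then 1 else 0) +
        (starRingEnd ℂ) (optCoeffRev χ j) * h i * (if i = j.rev then 1 else 0) := fun i => by
    rw [realDiag, Matrix.mul_diagonal, Matrix.conjTranspose_apply, optMatrix, Matrix.of_apply]
    simp only [star_add, star_mul', Complex.star_def, Complex.conj_ofReal]
    split_ifs <;> simp
    ring
  simp only [e, add_mul, Finset.sum_add_distrib]
  simp

/-- `optMatrix` mixes only `j` with `j.rev`. Conjugating a diagonal matrix leaves the pair averages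
on the diagonal and moves half the differences, up to a phase, to the antidiagonal. -/
theorem optMatrix_conj_diag (χ : ℝ) (h : Fin d → ℝ) (j : Fin d) :
    ((optMatrix d χ)ᴴ * realDiag h * optMatrix d χ) j j = (((h j + h j.rev) / 2 : ℝ) : ℂ) := by
  rw [optMatrix_conj_apply]
  simp only [optMatrix, Matrix.of_apply]
  have hr := ofReal_inv_sqrt_two_mul_self
  have hE : Complex.exp (Complex.I * (χ : ℂ)) * Complex.exp (-(Complex.I * (χ : ℂ))) = 1 := by
    rw [← Complex.exp_add]; simp
  rcases lt_trichotomy j j.rev with hj | hj | hj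
  · simp only [optCoeff, optCoeffRev, hj.ne, hj.ne', hj, if_true, if_false, map_mul,
      Complex.conj_ofReal, star_exp_I_mul]
    push_cast at *
    linear_combination (↑(h j) + ↑(h j.rev)) * hr + (1 / √2 : ℂ) * (1 / √2 : ℂ) * ↑(h j.rev) * hE
  · have e : optCoeffRev χ j = 0 := by
      rw [optCoeffRev, if_neg (by rw [← hj]; exact lt_irrefl _), if_pos hj]
    rw [e, optCoeff, if_pos hj, ← hj]
    simp
  · simp only [optCoeff, optCoeffRev, hj.ne, hj.ne', hj.not_gt, if_true, if_false, map_mul,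
      map_neg, Complex.conj_ofReal, star_exp_neg_I_mul]
    push_cast at *
    linear_combination (↑(h j) + ↑(h j.rev)) * hr + (1 / √2 : ℂ) * (1 / √2 : ℂ) * ↑(h j.rev) * hE

theorem optMatrix_conj_rev (χ : ℝ) (h : Fin d → ℝ) {j : Fin d} (hj0 : j ≠ j.rev) :
    ((optMatrix d χ)ᴴ * realDiag h * optMatrix d χ) j j.rev =
      (if j < j.rev then Complex.exp (-(Complex.I * (χ : ℂ))) else
        -Complex.exp (Complex.I * (χ : ℂ))) * (((h j.rev - h j) / 2 : ℝ) : ℂ) := by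
  rw [optMatrix_conj_apply]
  simp only [optMatrix, Matrix.of_apply]
  have hr := ofReal_inv_sqrt_two_mul_self
  rcases lt_or_gt_of_ne hj0 with hj | hj
  · simp only [optCoeff, optCoeffRev, Fin.rev_rev, hj.ne, hj.ne', hj, hj.not_gt, if_true, if_false,
      map_mul, Complex.conj_ofReal, star_exp_I_mul]
    push_cast at *
    linear_combination Complex.exp (-(Complex.I * (χ : ℂ))) * (↑(h j.rev) - ↑(h j)) * hr
  · simp only [optCoeff, optCoeffRev, Fin.rev_rev, hj.ne, hj.ne', hj, hj.not_gt, if_true, if_false,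
      map_mul, map_neg, Complex.conj_ofReal, star_exp_neg_I_mul]
    push_cast at *
    linear_combination -Complex.exp (Complex.I * (χ : ℂ)) * (↑(h j.rev) - ↑(h j)) * hr

theorem optMatrix_conj_of_ne (χ : ℝ) (h : Fin d → ℝ) {j k : Fin d} (h1 : k ≠ j)
    (h2 : k ≠ j.rev) : ((optMatrix d χ)ᴴ * realDiag h * optMatrix d χ) j k = 0 := by
  rw [optMatrix_conj_apply]
  have h3 : j ≠ k.rev := fun h => h2 (by rw [h, Fin.rev_rev])
  have h4 : j.rev ≠ k.rev := fun h => h1 (Fin.rev_injective h).symm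
  simp [optMatrix, h1.symm, h2.symm, h3, h4]

theorem optMatrix_mem_unitaryGroup (χ : ℝ) :
    (optMatrix d χ : Matrix (Fin d) (Fin d) ℂ) ∈ Matrix.unitaryGroup (Fin d) ℂ := by
  rw [Matrix.mem_unitaryGroup_iff', Matrix.star_eq_conjTranspose]
  have e : (optMatrix d χ : Matrix (Fin d) (Fin d) ℂ)ᴴ * optMatrix d χ =
      (optMatrix d χ)ᴴ * realDiag (fun _ => 1) * optMatrix d χ := by rw [realDiag_one, mul_one]
  rw [e]
  ext j k
  by_cases h1 : k = j
  · rw [h1, optMatrix_conj_diag, Matrix.one_apply_eq]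
    norm_num
  · rw [Matrix.one_apply_ne (Ne.symm h1)]
    by_cases h2 : k = j.rev
    · rw [h2, optMatrix_conj_rev χ _ (h2 ▸ Ne.symm h1)]
      simp
    · exact optMatrix_conj_of_ne χ _ h1 h2

/-- For m ≤ n the block avoids the diagonal, so only antidiagonal entries count; the block bound
becomes an equality, simultaneously for all m ≤ n. -/
theorem weightedSum_blockWeight_optMatrix (χ : ℝ) (h : Fin d → ℝ) {m n : ℕ} (hmn : m ≤ n) :
    weightedSum (blockWeight m n) ((optMatrix d χ)ᴴ * realDiag h * optMatrix d χ) =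
      ∑ i : Fin d, blockWeight m n i i.rev * ((h i - h i.rev) ^ 2 / 4) := by
  rw [weightedSum]
  refine Finset.sum_congr rfl fun j _ => ?_
  have hjj : blockWeight m n j j = 0 := by rw [blockWeight, if_neg (by omega)]
  rw [Finset.sum_eq_single j.rev]
  · by_cases hj : j = j.rev
    · rw [← hj, hjj]
      simp
    · rw [optMatrix_conj_rev χ h hj, Complex.normSq_mul, Complex.normSq_ofReal]
      have e : Complex.normSq (if j < j.rev then Complex.exp (-(Complex.I * (χ : ℂ))) else
          -Complex.exp (Complex.I * (χ : ℂ))) = 1 := by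
        split_ifs
        · exact normSq_exp_neg_I_mul χ
        · rw [Complex.normSq_neg, normSq_exp_I_mul]
      rw [e]
      ring
  · intro k _ hk
    by_cases h1 : k = j
    · rw [h1, hjj, zero_mul]
    · rw [optMatrix_conj_of_ne χ h h1 hk]
      simp
  · simp

end Optimal

/-! ### Comparison of the two sets of maximizers -/

section Maximizers

variable {d : ℕ}

/-- The generator in the eigenbasis of the probe state `U ρ U†`, where the columns of `A` are
eigenvectors of `ρ`. -/
def rotated (H : Matrix (Fin d) (Fin d) ℂ) (A U : Matrix.unitaryGroup (Fin d) ℂ) :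
    Matrix (Fin d) (Fin d) ℂ :=
  ((U * A : Matrix.unitaryGroup (Fin d) ℂ) : Matrix (Fin d) (Fin d) ℂ)ᴴ * H *
    ((U * A : Matrix.unitaryGroup (Fin d) ℂ) : Matrix (Fin d) (Fin d) ℂ)

theorem prep_conj (A U : Matrix.unitaryGroup (Fin d) ℂ) (l : Fin d → ℝ) :
    prep ((A : Matrix (Fin d) (Fin d) ℂ) * realDiag l * (A : Matrix (Fin d) (Fin d) ℂ)ᴴ) U =
      ((U * A : Matrix.unitaryGroup (Fin d) ℂ) : Matrix (Fin d) (Fin d) ℂ) * realDiag l *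
        ((U * A : Matrix.unitaryGroup (Fin d) ℂ) : Matrix (Fin d) (Fin d) ℂ)ᴴ := by
  simp [prep, Matrix.conjTranspose_mul, mul_assoc]

theorem spectrum_of_isState {ρ : Matrix (Fin d) (Fin d) ℂ} (hρ : IsState ρ)
    {A : Matrix.unitaryGroup (Fin d) ℂ} {l : Fin d → ℝ}
    (hA : ρ = A * realDiag l * (A : Matrix (Fin d) (Fin d) ℂ)ᴴ) :
    (∀ i, 0 ≤ l i) ∧ ∑ i, l i = 1 := by
  refine ⟨nonneg_of_posSemidef_conj A (hA ▸ hρ.1), ?_⟩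
  have h := congrArg Complex.re hρ.2
  rw [hA, trace_conj, trace_realDiag] at h
  simpa using h

/-- A probe unitary is optimal for a weight with positive block coefficients exactly at the gap
pairs if and only if it saturates all the corresponding block bounds. -/
theorem forall_weightedSum_le_iff {H : Matrix (Fin d) (Fin d) ℂ}
    (A B : Matrix.unitaryGroup (Fin d) ℂ) {h : Fin d → ℝ} (hh : Antitone h)
    (hB : H = B * realDiag h * (B : Matrix (Fin d) (Fin d) ℂ)ᴴ) (l : Fin d → ℝ)
    {U₀ : Matrix.unitaryGroup (Fin d) ℂ} {χ : ℝ}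
    (hU₀ : rotated H A U₀ = (optMatrix d χ)ᴴ * realDiag h * optMatrix d χ)
    {g : ℝ → ℝ → ℝ} (hg : ∀ x, g x x = 0) (hsymm : ∀ x y, g x y = g y x)
    (hsign : ∀ m n, 0 ≤ blockCoeff g (extendZero l) m n ∧
      (0 < blockCoeff g (extendZero l) m n ↔ IsGapPair (extendZero l) m n))
    (U : Matrix.unitaryGroup (Fin d) ℂ) :
    (∀ V, 2 * weightedSum (fun j k => g (l j) (l k)) (rotated H A V) ≤
      2 * weightedSum (fun j k => g (l j) (l k)) (rotated H A U)) ↔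
      ∀ p ∈ Finset.range d ×ˢ Finset.range d, IsGapPair (extendZero l) p.1 p.2 →
        weightedSum (blockWeight (p.1 + 1) (p.2 + 1)) (rotated H A U) =
          weightedSum (blockWeight (p.1 + 1) (p.2 + 1)) (rotated H A U₀) := by
  have hH : H.IsHermitian := by
    rw [Matrix.IsHermitian, hB]
    simp [Matrix.conjTranspose_mul, mul_assoc]
  have hK : ∀ V, (rotated H A V).IsHermitian := fun V => isHermitian_conj hH _
  simp only [weightedSum_eq_sum_blockCoeff hg hsymm l (hK _), mul_le_mul_iff_right₀ two_pos]
  rw [forall_sum_mul_le_iff (Finset.range d ×ˢ Finset.range d) (fun p => (hsign p.1 p.2).1)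
    (fun (V : Matrix.unitaryGroup (Fin d) ℂ) p =>
      weightedSum (blockWeight (p.1 + 1) (p.2 + 1)) (rotated H A V)) U₀ ?_ U]
  · simp only [(hsign _ _).2]
  · intro p hp V
    have hmn : p.1 + 1 ≤ p.2 + 1 := Nat.succ_le_succ ((hsign _ _).2.mp hp).1
    rw [hU₀, weightedSum_blockWeight_optMatrix χ h hmn]
    -- Every rotated generator has the spectrum `h` of H, so the same bound holds for all V.
    refine weightedSum_blockWeight_le ((V * A)⁻¹ * B) hh ?_ hmn
    have e : (((V * A)⁻¹ * B : Matrix.unitaryGroup (Fin d) ℂ) : Matrix (Fin d) (Fin d) ℂ) =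
      ((V * A : Matrix.unitaryGroup (Fin d) ℂ) : Matrix (Fin d) (Fin d) ℂ)ᴴ * B := rfl
    rw [rotated, hB, e]
    simp [Matrix.conjTranspose_mul, mul_assoc]

variable {ρ H : Matrix (Fin d) (Fin d) ℂ}

theorem tendsto_quotients_prep (hρ : IsState ρ) (hH : H.IsHermitian)
    {A : Matrix.unitaryGroup (Fin d) ℂ} {l : Fin d → ℝ}
    (hA : ρ = A * realDiag l * (A : Matrix (Fin d) (Fin d) ℂ)ᴴ) (θ : ℝ)
    (U : Matrix.unitaryGroup (Fin d) ℂ) :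
    Tendsto (subQfiQuotient (family H (prep ρ U)) θ) (𝓝[≠] 0)
      (𝓝 (2 * weightedSum (fun j k => (l j - l k) ^ 2) (rotated H A U))) ∧
    Tendsto (qfiQuotient (family H (prep ρ U)) θ) (𝓝[≠] 0)
      (𝓝 (2 * weightedSum (fun j k => qfiWeight (l j) (l k)) (rotated H A U))) := by
  obtain ⟨hl, hl1⟩ := spectrum_of_isState hρ hA
  rw [hA, prep_conj]
  exact ⟨tendsto_subQfiQuotient hH (U * A) hl hl1 θ, tendsto_qfiQuotient hH (U * A) hl hl1 θ⟩

/-- The optimal unitary attached to sorted spectral decompositions maximizes both quantities, whose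
maximizers agree. -/
theorem argmax_of_decompositions (hρ : IsState ρ) {A B : Matrix.unitaryGroup (Fin d) ℂ}
    {l h : Fin d → ℝ} (hl : Antitone l) (hh : Antitone h)
    (hA : ρ = A * realDiag l * (A : Matrix (Fin d) (Fin d) ℂ)ᴴ)
    (hB : H = B * realDiag h * (B : Matrix (Fin d) (Fin d) ℂ)ᴴ) (θ χ : ℝ) :
    argmaxSubQfi ρ H θ = argmaxQfi ρ H θ ∧
      ∃ U, prep ρ U = (B * optMatrix d χ : Matrix (Fin d) (Fin d) ℂ) * realDiag l *
        (B * optMatrix d χ : Matrix (Fin d) (Fin d) ℂ)ᴴ ∧ U ∈ argmaxSubQfi ρ H θ := by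
  have hH : H.IsHermitian := by
    rw [Matrix.IsHermitian, hB]
    simp [Matrix.conjTranspose_mul, mul_assoc]
  obtain ⟨hl0, -⟩ := spectrum_of_isState hρ hA
  let Φ : Matrix.unitaryGroup (Fin d) ℂ := ⟨optMatrix d χ, optMatrix_mem_unitaryGroup χ⟩
  -- Chosen to carry the eigenvectors of ρ (columns of A) to the optimal vectors (columns of BΦ).
  let U₀ := B * Φ * A⁻¹
  have hU₀A : U₀ * A = B * Φ := by simp [U₀, mul_assoc]
  have hU₀ : rotated H A U₀ = (optMatrix d χ)ᴴ * realDiag h * optMatrix d χ := by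
    rw [rotated, hU₀A, hB]
    simp [Φ, Matrix.conjTranspose_mul, mul_assoc]
  have ha := extendZero_antitone hl0 hl
  have ha0 := extendZero_nonneg hl0
  have hsub : ∀ U, subQfi (family H (prep ρ U)) θ =
      2 * weightedSum (fun j k => (l j - l k) ^ 2) (rotated H A U) := fun U =>
    (tendsto_quotients_prep hρ hH hA θ U).1.limUnder_eq
  have hqfi : ∀ U, qfi (family H (prep ρ U)) θ =
      2 * weightedSum (fun j k => qfiWeight (l j) (l k)) (rotated H A U) := fun U =>
    (tendsto_quotients_prep hρ hH hA θ U).2.limUnder_eq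
  have h1 := fun U => forall_weightedSum_le_iff A B hh hB l hU₀ (g := fun x y => (x - y) ^ 2)
    (fun x => by simp) (fun x y => by ring) (subQfiBlockCoeff_sign ha ha0) U
  have h2 := fun U => forall_weightedSum_le_iff A B hh hB l hU₀ qfiWeight_self qfiWeight_comm
    (qfiBlockCoeff_sign ha ha0) U
  refine ⟨?_, U₀, ?_, ?_⟩
  · ext U
    simp only [argmaxSubQfi, argmaxQfi, Set.mem_ofPred_eq, hsub, hqfi]
    rw [h1 U, h2 U]
  · rw [hA, prep_conj, hU₀A]
    rfl
  · simp only [argmaxSubQfi, Set.mem_ofPred_eq, hsub]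
    rw [h1 U₀]
    exact fun _ _ _ => rfl

end Maximizers

end SubQFI

theorem theorem2 {d : ℕ} (ρ H : Matrix (Fin d) (Fin d) ℂ) (hρ : SubQFI.IsState ρ)
    (hH : H.IsHermitian) (θ : ℝ) :
    (∀ U : Matrix.unitaryGroup (Fin d) ℂ,
      Tendsto (SubQFI.subQfiQuotient (SubQFI.family H (SubQFI.prep ρ U)) θ) (𝓝[≠] (0 : ℝ))
        (𝓝 (SubQFI.subQfi (SubQFI.family H (SubQFI.prep ρ U)) θ)) ∧
      Tendsto (SubQFI.qfiQuotient (SubQFI.family H (SubQFI.prep ρ U)) θ) (𝓝[≠] (0 : ℝ))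
        (𝓝 (SubQFI.qfi (SubQFI.family H (SubQFI.prep ρ U)) θ))) ∧
    (SubQFI.argmaxSubQfi ρ H θ).Nonempty ∧
    SubQFI.argmaxSubQfi ρ H θ = SubQFI.argmaxQfi ρ H θ ∧
    ∀ (l h : Fin d → ℝ) (a b : OrthonormalBasis (Fin d) ℂ (EuclideanSpace ℂ (Fin d))),
      Antitone l → Antitone h → ρ = SubQFI.spectralSum l a → H = SubQFI.spectralSum h b →
      ∀ χ : ℝ,
        (∃ U : Matrix.unitaryGroup (Fin d) ℂ,
          SubQFI.prep ρ U = SubQFI.spectralSum l (SubQFI.optVec b χ)) ∧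
        ∀ U : Matrix.unitaryGroup (Fin d) ℂ,
          SubQFI.prep ρ U = SubQFI.spectralSum l (SubQFI.optVec b χ) →
          U ∈ SubQFI.argmaxSubQfi ρ H θ ∧ U ∈ SubQFI.argmaxQfi ρ H θ := by
  obtain ⟨A, l, hA, hl⟩ := SubQFI.exists_unitary_realDiag hρ.1.1
  obtain ⟨B, h, hB, hh⟩ := SubQFI.exists_unitary_realDiag hH
  obtain ⟨heq, U₀, -, hU₀⟩ := SubQFI.argmax_of_decompositions hρ hl hh hA hB θ 0
  refine ⟨fun U => ?_, ⟨U₀, hU₀⟩, heq, fun l h a b hl hh ha hb χ => ?_⟩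
  · have ht := SubQFI.tendsto_quotients_prep hρ hH hA θ U
    rw [SubQFI.subQfi, SubQFI.qfi, ht.1.limUnder_eq, ht.2.limUnder_eq]
    exact ht
  · rw [SubQFI.spectralSum_eq] at ha hb
    obtain ⟨-, U₁, hU₁, hmax⟩ := SubQFI.argmax_of_decompositions hρ (θ := θ) (χ := χ)
      (A := ⟨_, SubQFI.columns_mem_unitaryGroup a⟩)
      (B := ⟨_, SubQFI.columns_mem_unitaryGroup b⟩) hl hh ha hb
    rw [SubQFI.spectralSum_eq, SubQFI.columns_optVec]
    refine ⟨⟨U₁, hU₁⟩, fun U hU => ?_⟩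
    have hmem : U ∈ SubQFI.argmaxSubQfi ρ H θ := by
      intro V
      -- The sub-QFI depends on the unitary only through the state it prepares, so any unitary
      -- preparing ρ* inherits optimality.
      rw [hU.trans hU₁.symm]
      exact hmax V
    exact ⟨hmem, heq ▸ hmem⟩
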